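/- Let $\Bbbk$ be any field (no restriction on the characteristic) and let $n\ge 1$. **The category $Web(SL_n^-)$.** This is the $\Bbbk$-linear strict monoidal category whose objects are the finite sequences in $\{1,\dots,n\}$ (tensor product: concatenation), whose morphisms are generated by trivalent vertices $(j,k)\to(j+k)$ (merge) and $(j+k)\to(j,k)$ (split) for $j,k\ge1$, $j+k\le n$, and univalent vertices $(n)\to\emptyset$ and $\emptyset\to(n)$, subject to the following relations. (1) Merges are associative and splits are coassociative. (2) Bigon bursting: the split $(j+k)\to(j,k)$ followed by the merge $(j,k)\to(j+k)$ is $\binom{j+k}{j}$ times the identity. (3) Square switch relations. Let $F^{(r)}\colon(a,b)\to(a-r,b+r)$ be the web that splits off a strand labelled $r$ from the left upright and merges it into the right one, and let $E^{(r)}\colon(a,b)\to(a+r,b-r)$ be its mirror image. Then on $(m,\ell)$ $$E^{(j)}F^{(k)}=\sum_t\binom{m-\ell+j-k}{t}F^{(k-t)}E^{(j-t)},\qquad F^{(j)}E^{(k)}=\sum_t\binom{\ell-m+j-k}{t}E^{(k-t)}F^{(j-t)},$$ where $0\le t\le\min(j,k)$, binomial coefficients are the generalized ones $\binom{x}{t}=x(x-1)\cdots(x-t+1)/t!$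 for $x\in\mathbb Z$, strands labelled $0$ are erased, and webs with a label that is negative or larger than $n$ are zero. (4) The two univalent vertices are mutually inverse. (5) For $1\le m\le n-1$, let $\mathrm{cup}_{a,b}\colon\emptyset\to(n)\to(a,b)$ and $\mathrm{cap}_{a,b}\colon(a,b)\to(n)\to\emptyset$ ($a+b=n$) be the composites of univalent and trivalent vertices. Then $$\mathrm{id}_m=(\mathrm{cap}_{m,n-m}\otimes\mathrm{id}_m)(\mathrm{id}_m\otimes\mathrm{cup}_{n-m,m})=(\mathrm{id}_m\otimes\mathrm{cap}_{n-m,m})(\mathrm{cup}_{m,n-m}\otimes\mathrm{id}_m).$$ **The graph planar algebra.** Let $\Gamma$ be the $sl_n$ weight lattice $\mathbb Z\{L_1,\dots,L_n\}/(L_1+\dots+L_n)$, viewed as a directed graph with an edge from $x$ to $x+\sum_{i\in A}L_i$ labelled $|A|$ for every proper nonempty subset $A\subset\{1,\dots,n\}$. The category $G(\Gamma)$ over $\Bbbk$ has as objects the finite sequences of edge labels. A morphism $\sigma\to\tau$ is a $\Bbbk$-valued function on pairs $(p,q)$ of paths in $\Gamma$ with edge labels $\sigma$ and $\tau$ respectively,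 vanishing unless $p$ and $q$ match, i.e. have the same starting point and the same end point. Composition is $(g\circ f)(p,q)=\sum_{r}f(p,r)\,g(r,q)$, the sum being over the paths $r$ of the intermediate type that match $p$ (equivalently $q$). The tensor product is concatenation on objects and $(f\otimes g)(p_1p_2,q_1q_2)=f(p_1,q_1)\,g(p_2,q_2)$ on morphisms. This is a $\Bbbk$-linear strict monoidal category. **Theorem.** There is a $\Bbbk$-linear strict monoidal functor $Web(SL_n^-)\to G(\Gamma)$ which sends a sequence in $\{1,\dots,n\}$ to the sequence obtained by replacing every entry $n$ by the empty sequence, and which sends every generating trivalent or univalent vertex to the indicator function of cycles: its value on a matched pair $(p,q)$ is $1$ if following $p$ and returning along $q$ is a cycle (it visits no vertex twice; for two paths of length $0$ at the same vertex this always holds), and $0$ otherwise. -/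

import Mathlib

open CategoryTheory

universe u v w

/-! ## Graph planar algebras -/

/-- A locally finite directed graph on the vertex set `V` whose edges carry labels in `L`:
`Edge x y l` says that there is an edge `x ⟶ y` labelled `l`. -/
structure LabeledGraph (V : Type v) (L : Type w) where
  Edge : V → V → L → Prop
  locallyFinite : ∀ x l, {y | Edge x y l}.Finite

namespace LabeledGraph

variable {V : Type v} {L : Type w}

/-- `Γ.IsWalk x σ vs`: the vertices `vs` are, in order, the vertices visited after `x` by a walk
that starts at `x` and whose successive edges are labelled by the entries of `σ`. -/
def IsWalk (Γ : LabeledGraph V L) : V → List L → List V → Prop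
  | _, [], [] => True
  | x, l :: σ, y :: ys => Γ.Edge x y l ∧ Γ.IsWalk y σ ys
  | _, [], _ :: _ => False
  | _, _ :: _, [] => False

/-- Paths of type `σ` in `Γ`. -/
@[ext]
structure Path (Γ : LabeledGraph V L) (σ : List L) where
  src : V
  rest : List V
  isWalk : Γ.IsWalk src σ rest

theorem IsWalk.length_eq {Γ : LabeledGraph V L} : ∀ {x : V} {σ : List L} {vs : List V},
    Γ.IsWalk x σ vs → vs.length = σ.length
  | _, [], [], _ => rfl
  | _, _ :: _, _ :: _, h => by simpa using IsWalk.length_eq h.2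
  | _, [], _ :: _, h => h.elim
  | _, _ :: _, [], h => h.elim

theorem isWalk_append {Γ : LabeledGraph V L} {τ : List L} : ∀ {x : V} {σ : List L} {vs : List V},
    Γ.IsWalk x (σ ++ τ) vs ↔ Γ.IsWalk x σ (vs.take σ.length) ∧
      Γ.IsWalk ((vs.take σ.length).getLastD x) τ (vs.drop σ.length)
  | x, [], vs => by simp [IsWalk]
  | x, l :: σ, [] => by simp [IsWalk]
  | x, l :: σ, y :: ys => by
      have := isWalk_append (Γ := Γ) (τ := τ) (x := y) (σ := σ) (vs := ys)
      simp only [List.cons_append, IsWalk, this, List.length_cons, List.take_succ_cons,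
        List.drop_succ_cons, List.getLastD_cons, and_assoc]

theorem finite_isWalk (Γ : LabeledGraph V L) : ∀ (σ : List L) (x : V),
    {vs | Γ.IsWalk x σ vs}.Finite
  | [], x => by
      refine (Set.finite_singleton ([] : List V)).subset ?_
      rintro (_ | ⟨y, ys⟩) h
      · simp
      · exact h.elim
  | l :: σ, x => by
      refine ((Γ.locallyFinite x l).biUnion
        (t := fun y => List.cons y '' {vs | Γ.IsWalk y σ vs})
        fun y _ => (finite_isWalk Γ σ y).image _).subset ?_
      rintro (_ | ⟨y, ys⟩) h
      · exact h.elim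
      · simp only [Set.mem_iUnion]
        exact ⟨y, h.1, ys, h.2, rfl⟩

namespace Path

variable {Γ : LabeledGraph V L} {σ τ ρ : List L}

/-- The end point of a path. -/
def tgt (p : Γ.Path σ) : V := p.rest.getLastD p.src

/-- The list of all vertices of a path, in order. -/
def verts (p : Γ.Path σ) : List V := p.src :: p.rest

/-- Two paths match if their starting points and their end points coincide. -/
def Matched (p : Γ.Path σ) (q : Γ.Path τ) : Prop := p.src = q.src ∧ p.tgt = q.tgt

theorem Matched.symm {p : Γ.Path σ} {q : Γ.Path τ} (h : p.Matched q) : q.Matched p :=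
  ⟨h.1.symm, h.2.symm⟩

theorem Matched.trans {p : Γ.Path σ} {q : Γ.Path τ} {r : Γ.Path ρ} (h : p.Matched q)
    (h' : q.Matched r) : p.Matched r :=
  ⟨h.1.trans h'.1, h.2.trans h'.2⟩

/-- The initial segment of type `σ` of a path of type `σ ++ τ`. -/
def left (σ τ : List L) (p : Γ.Path (σ ++ τ)) : Γ.Path σ :=
  ⟨p.src, p.rest.take σ.length, (isWalk_append.1 p.isWalk).1⟩

/-- The final segment of type `τ` of a path of type `σ ++ τ`. -/
def right (σ τ : List L) (p : Γ.Path (σ ++ τ)) : Γ.Path τ :=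
  ⟨(p.left σ τ).tgt, p.rest.drop σ.length, (isWalk_append.1 p.isWalk).2⟩

/-- Concatenation of paths. -/
def append (p : Γ.Path σ) (q : Γ.Path τ) (h : p.tgt = q.src) : Γ.Path (σ ++ τ) :=
  ⟨p.src, p.rest ++ q.rest, by
    have hl : p.rest.length = σ.length := p.isWalk.length_eq
    refine isWalk_append.2 ⟨?_, ?_⟩
    · rw [← hl, List.take_left]; exact p.isWalk
    · rw [← hl, List.take_left, List.drop_left]
      have : p.rest.getLastD p.src = q.src := h
      rw [this]; exact q.isWalk⟩

theorem left_append (p : Γ.Path σ) (q : Γ.Path τ) (h : p.tgt = q.src) :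
    (p.append q h).left σ τ = p := by
  have hl : p.rest.length = σ.length := p.isWalk.length_eq
  ext1
  · rfl
  · simp [left, append, ← hl]

theorem right_append (p : Γ.Path σ) (q : Γ.Path τ) (h : p.tgt = q.src) :
    (p.append q h).right σ τ = q := by
  have hl : p.rest.length = σ.length := p.isWalk.length_eq
  ext1
  · change ((p.append q h).left σ τ).tgt = _
    rw [left_append, h]
  · simp [right, append, ← hl]

theorem eq_of_left_right {p q : Γ.Path (σ ++ τ)} (h : p.left σ τ = q.left σ τ)
    (h' : p.right σ τ = q.right σ τ) : p = q := by
  ext1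
  · exact congrArg (Path.src (Γ := Γ) (σ := σ)) h
  · have h1 : p.rest.take σ.length = q.rest.take σ.length := congrArg (Path.rest (Γ := Γ)) h
    have h2 : p.rest.drop σ.length = q.rest.drop σ.length := congrArg (Path.rest (Γ := Γ)) h'
    rw [← List.take_append_drop σ.length p.rest, h1, h2, List.take_append_drop]

theorem tgt_right (p : Γ.Path (σ ++ τ)) : (p.right σ τ).tgt = p.tgt := by
  change (p.rest.drop _).getLastD ((p.rest.take _).getLastD p.src) = p.rest.getLastD p.src
  conv_rhs => rw [← List.take_append_drop σ.length p.rest]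
  simp only [List.getLastD_eq_getLast?, List.getLast?_append]
  cases (List.drop σ.length p.rest).getLast? <;> simp

theorem matched_of_left_right {σ' τ' : List L} {p : Γ.Path (σ ++ τ)} {q : Γ.Path (σ' ++ τ')}
    (h : (p.left σ τ).Matched (q.left σ' τ')) (h' : (p.right σ τ).Matched (q.right σ' τ')) :
    p.Matched q :=
  ⟨h.1, by rw [← tgt_right, ← tgt_right]; exact h'.2⟩

theorem finite_matched (p : Γ.Path σ) (τ : List L) : {q : Γ.Path τ | p.Matched q}.Finite := by
  refine Set.Finite.of_finite_image (f := Path.rest)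
    ((Γ.finite_isWalk τ p.src).subset ?_) ?_
  · rintro _ ⟨q, hq, rfl⟩
    have h : p.src = q.src := hq.1
    change Γ.IsWalk p.src τ q.rest
    rw [h]; exact q.isWalk
  · intro q hq r hr h
    exact Path.ext (hq.1.symm.trans hr.1) h

/-- The finite set of all paths of type `τ` that match `p`. -/
noncomputable def matching (p : Γ.Path σ) (τ : List L) : Finset (Γ.Path τ) :=
  (p.finite_matched τ).toFinset

theorem mem_matching {p : Γ.Path σ} {q : Γ.Path τ} : q ∈ p.matching τ ↔ p.Matched q := by
  simp [matching]

/-- Two matched paths bound a cycle if the closed walk that follows the first path and returns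
along the second one visits no vertex twice. (If both paths have length `0` and are equal,
this always holds.) -/
def BoundsCycle (p : Γ.Path σ) (q : Γ.Path τ) : Prop :=
  p.Matched q ∧ (p.verts.dropLast ++ q.verts.tail.reverse).Nodup

end Path

end LabeledGraph

/-- The graph planar algebra `G(Γ)` over `k`: its objects are finite sequences of edge labels. -/
@[ext]
structure GPA (k : Type u) {V : Type v} {L : Type w} (Γ : LabeledGraph V L) where
  seq : List L

namespace GPA

variable {k : Type u} {V : Type v} {L : Type w} {Γ : LabeledGraph V L}

/-- The tensor product of two objects: concatenation of sequences. -/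
def tensorObj (X Y : GPA k Γ) : GPA k Γ := ⟨X.seq ++ Y.seq⟩

theorem tensorObj_assoc (X Y Z : GPA k Γ) :
    tensorObj (tensorObj X Y) Z = tensorObj X (tensorObj Y Z) :=
  congrArg mk (List.append_assoc _ _ _)

theorem tensorObj_nil (X : GPA k Γ) : tensorObj X ⟨[]⟩ = X :=
  congrArg mk (List.append_nil _)

theorem nil_tensorObj (X : GPA k Γ) : tensorObj ⟨[]⟩ X = X := rfl

variable [Field k]

/-- A morphism `X ⟶ Y`: a `k`-valued function on pairs of paths of types `X` and `Y` (that is, a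
linear functional on the vector space freely spanned by these pairs) that vanishes on the
pairs that do not match. -/
@[ext]
structure Hom (X Y : GPA k Γ) where
  toFun : Γ.Path X.seq → Γ.Path Y.seq → k
  vanish : ∀ p q, ¬ p.Matched q → toFun p q = 0

open Classical in
/-- The identity morphism. -/
noncomputable def Hom.id (X : GPA k Γ) : Hom X X where
  toFun p q := if p = q then 1 else 0
  vanish p q h := if_neg fun e => h (by subst e; exact ⟨rfl, rfl⟩)

/-- Composition: the sum over all matching paths of the intermediate type. -/
noncomputable def Hom.comp {X Y Z : GPA k Γ} (f : Hom X Y) (g : Hom Y Z) : Hom X Z where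
  toFun p q := ∑ r ∈ p.matching Y.seq, f.toFun p r * g.toFun r q
  vanish p q h := Finset.sum_eq_zero fun r hr => by
    rw [g.vanish r q fun h' => h ((LabeledGraph.Path.mem_matching.1 hr).trans h'), mul_zero]

theorem Hom.id_comp {X Y : GPA k Γ} (f : Hom X Y) : (Hom.id X).comp f = f := by
  classical
  ext p q
  refine (Finset.sum_eq_single p ?_ ?_).trans ?_
  · intro r _ h
    simp [Hom.id, h.symm]
  · intro h
    exact (h (LabeledGraph.Path.mem_matching.2 ⟨rfl, rfl⟩)).elim
  · simp [Hom.id]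

theorem Hom.comp_id {X Y : GPA k Γ} (f : Hom X Y) : f.comp (Hom.id Y) = f := by
  classical
  ext p q
  refine (Finset.sum_eq_single q ?_ ?_).trans ?_
  · intro r _ h
    simp [Hom.id, h]
  · intro h
    rw [f.vanish p q fun h' => h (LabeledGraph.Path.mem_matching.2 h'), zero_mul]
  · simp [Hom.id]

theorem Hom.comp_assoc {X Y Z W : GPA k Γ} (f : Hom X Y) (g : Hom Y Z) (h : Hom Z W) :
    (f.comp g).comp h = f.comp (g.comp h) := by
  ext p q
  simp only [Hom.comp, Finset.sum_mul, Finset.mul_sum]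
  rw [Finset.sum_comm]
  refine Finset.sum_congr rfl fun r hr => ?_
  have hr' := LabeledGraph.Path.mem_matching.1 hr
  refine Finset.sum_congr ?_ fun s _ => mul_assoc _ _ _
  ext s
  rw [LabeledGraph.Path.mem_matching, LabeledGraph.Path.mem_matching]
  exact ⟨fun h => hr'.symm.trans h, fun h => hr'.trans h⟩

noncomputable instance : Category (GPA k Γ) where
  Hom := Hom
  id := Hom.id
  comp := Hom.comp
  id_comp := Hom.id_comp
  comp_id := Hom.comp_id
  assoc := Hom.comp_assoc

@[ext]
theorem hom_ext {X Y : GPA k Γ} {f g : X ⟶ Y} (h : ∀ p q, f.toFun p q = g.toFun p q) : f = g :=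
  Hom.ext (funext fun p => funext fun q => h p q)

theorem comp_toFun {X Y Z : GPA k Γ} (f : X ⟶ Y) (g : Y ⟶ Z) (p : Γ.Path X.seq)
    (q : Γ.Path Z.seq) :
    (f ≫ g).toFun p q = ∑ r ∈ p.matching Y.seq, f.toFun p r * g.toFun r q := rfl

/-! ### The linear structure (pointwise) -/

instance (X Y : GPA k Γ) : Zero (X ⟶ Y) := ⟨⟨fun _ _ => 0, fun _ _ _ => rfl⟩⟩
instance (X Y : GPA k Γ) : Add (X ⟶ Y) :=
  ⟨fun f g => ⟨fun p q => f.toFun p q + g.toFun p q, fun p q h => by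
    rw [f.vanish p q h, g.vanish p q h, add_zero]⟩⟩
instance (X Y : GPA k Γ) : Neg (X ⟶ Y) :=
  ⟨fun f => ⟨fun p q => - f.toFun p q, fun p q h => by rw [f.vanish p q h, neg_zero]⟩⟩
instance (X Y : GPA k Γ) : SMul k (X ⟶ Y) :=
  ⟨fun c f => ⟨fun p q => c * f.toFun p q, fun p q h => by rw [f.vanish p q h, mul_zero]⟩⟩

@[simp] theorem zero_toFun {X Y : GPA k Γ} (p : Γ.Path X.seq) (q : Γ.Path Y.seq) :
    (0 : X ⟶ Y).toFun p q = 0 := rfl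
@[simp] theorem add_toFun {X Y : GPA k Γ} (f g : X ⟶ Y) (p : Γ.Path X.seq) (q : Γ.Path Y.seq) :
    (f + g).toFun p q = f.toFun p q + g.toFun p q := rfl
@[simp] theorem neg_toFun {X Y : GPA k Γ} (f : X ⟶ Y) (p : Γ.Path X.seq) (q : Γ.Path Y.seq) :
    (-f).toFun p q = - f.toFun p q := rfl
@[simp] theorem smul_toFun {X Y : GPA k Γ} (c : k) (f : X ⟶ Y) (p : Γ.Path X.seq)
    (q : Γ.Path Y.seq) : (c • f).toFun p q = c * f.toFun p q := rfl

instance (X Y : GPA k Γ) : AddCommGroup (X ⟶ Y) where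
  add_assoc f g h := by ext; simp [add_assoc]
  zero_add f := by ext; simp
  add_zero f := by ext; simp
  add_comm f g := by ext; simp [add_comm]
  neg_add_cancel f := by ext; simp
  nsmul := nsmulRec
  zsmul := zsmulRec

instance (X Y : GPA k Γ) : Module k (X ⟶ Y) where
  one_smul f := by ext; simp
  mul_smul a b f := by ext; simp [mul_assoc]
  smul_zero a := by ext; simp
  smul_add a f g := by ext; simp [mul_add]
  add_smul a b f := by ext; simp [add_mul]
  zero_smul f := by ext; simp

instance : Preadditive (GPA k Γ) where
  add_comp X Y Z f f' g := by ext; simp [comp_toFun, add_mul, Finset.sum_add_distrib]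
  comp_add X Y Z f g g' := by ext; simp [comp_toFun, mul_add, Finset.sum_add_distrib]

instance : Linear k (GPA k Γ) where
  smul_comp X Y Z r f g := by ext; simp [comp_toFun, Finset.mul_sum, mul_assoc]
  comp_smul X Y Z f r g := by
    ext; simp only [comp_toFun, smul_toFun, Finset.mul_sum, mul_left_comm]

/-! ### The monoidal structure -/

/-- The tensor product of two morphisms. -/
def tensorHom {X Y X' Y' : GPA k Γ} (f : X ⟶ Y) (g : X' ⟶ Y') :
    tensorObj X X' ⟶ tensorObj Y Y' where
  toFun p q := f.toFun (p.left X.seq X'.seq) (q.left Y.seq Y'.seq) *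
    g.toFun (p.right X.seq X'.seq) (q.right Y.seq Y'.seq)
  vanish p q h := by
    by_cases h1 : (p.left X.seq X'.seq).Matched (q.left Y.seq Y'.seq)
    · rw [g.vanish _ _ fun h2 => h (LabeledGraph.Path.matched_of_left_right h1 h2), mul_zero]
    · rw [f.vanish _ _ h1, zero_mul]

theorem tensorHom_id (X Y : GPA k Γ) : tensorHom (𝟙 X) (𝟙 Y) = 𝟙 (tensorObj X Y) := by
  classical
  apply hom_ext
  intro p q
  change (if _ then (1 : k) else 0) * (if _ then 1 else 0) = if _ then 1 else 0
  by_cases h : p = q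
  · simp [h]
  · by_cases h1 : p.left X.seq Y.seq = q.left X.seq Y.seq
    · have h2 : p.right X.seq Y.seq ≠ q.right X.seq Y.seq := fun h2 =>
        h (LabeledGraph.Path.eq_of_left_right h1 h2)
      rw [if_neg h2, if_neg h, mul_zero]
    · rw [if_neg h1, if_neg h, zero_mul]

theorem tensorHom_comp {X Y Z X' Y' Z' : GPA k Γ} (f : X ⟶ Y) (g : Y ⟶ Z) (f' : X' ⟶ Y')
    (g' : Y' ⟶ Z') : tensorHom (f ≫ g) (f' ≫ g') = tensorHom f f' ≫ tensorHom g g' := by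
  classical
  apply hom_ext
  intro p q
  change (∑ r ∈ (p.left X.seq X'.seq).matching Y.seq, _) *
    (∑ s ∈ (p.right X.seq X'.seq).matching Y'.seq, _) =
    ∑ t ∈ p.matching (Y.seq ++ Y'.seq), _
  rw [Finset.sum_mul_sum, ← Finset.sum_product']
  symm
  refine Finset.sum_bij_ne_zero
    (fun (t : Γ.Path (Y.seq ++ Y'.seq)) _ _ => (t.left Y.seq Y'.seq, t.right Y.seq Y'.seq))
    ?_ ?_ ?_ ?_
  · intro t ht h0
    simp only [Finset.mem_product, LabeledGraph.Path.mem_matching]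
    constructor
    · by_contra h
      exact h0 (by simp only [tensorHom, f.vanish _ _ h, zero_mul])
    · by_contra h
      exact h0 (by simp only [tensorHom, f'.vanish _ _ h, mul_zero, zero_mul])
  · intro t _ _ t' _ _ h
    exact LabeledGraph.Path.eq_of_left_right (Prod.ext_iff.1 h).1 (Prod.ext_iff.1 h).2
  · rintro ⟨r, s⟩ hrs h0
    simp only [Finset.mem_product, LabeledGraph.Path.mem_matching] at hrs
    have hc : r.tgt = s.src := hrs.1.2.symm.trans hrs.2.1
    have hl := LabeledGraph.Path.left_append r s hc
    have hr := LabeledGraph.Path.right_append r s hc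
    refine ⟨r.append s hc, ?_, ?_, Prod.ext hl hr⟩
    · rw [LabeledGraph.Path.mem_matching]
      exact LabeledGraph.Path.matched_of_left_right (by rw [hl]; exact hrs.1)
        (by rw [hr]; exact hrs.2)
    · refine fun h => h0 (Eq.trans ?_ h)
      simp only [tensorHom, hl, hr]
      ring
  · intro t _ _
    simp only [tensorHom]
    ring

/-- A path, regarded as a path of an equal type. -/
def castPath {σ τ : List L} (h : σ = τ) (p : Γ.Path σ) : Γ.Path τ :=
  ⟨p.src, p.rest, h ▸ p.isWalk⟩

theorem comp_eqToHom_toFun {X Y Z : GPA k Γ} (f : X ⟶ Y) (h : Y = Z) (p : Γ.Path X.seq)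
    (q : Γ.Path Z.seq) :
    (f ≫ eqToHom h).toFun p q = f.toFun p (castPath (congrArg seq h.symm) q) := by
  subst h
  rw [eqToHom_refl, Category.comp_id]
  rfl

theorem eqToHom_comp_toFun {X Y Z : GPA k Γ} (h : X = Y) (f : Y ⟶ Z) (p : Γ.Path X.seq)
    (q : Γ.Path Z.seq) :
    (eqToHom h ≫ f).toFun p q = f.toFun (castPath (congrArg seq h) p) q := by
  subst h
  rw [eqToHom_refl, Category.id_comp]
  rfl

theorem tensorHom_eqToHom {X Y X' Y' : GPA k Γ} (h : X = Y) (h' : X' = Y') :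
    tensorHom (eqToHom h) (eqToHom h') = eqToHom (by rw [h, h']) := by
  subst h h'
  exact tensorHom_id _ _

theorem tensorHom_assoc {X Y Z X' Y' Z' : GPA k Γ} (f : X ⟶ X') (g : Y ⟶ Y') (h : Z ⟶ Z') :
    tensorHom (tensorHom f g) h ≫ eqToHom (tensorObj_assoc X' Y' Z') =
      eqToHom (tensorObj_assoc X Y Z) ≫ tensorHom f (tensorHom g h) := by
  apply hom_ext
  intro p q
  rw [comp_eqToHom_toFun, eqToHom_comp_toFun]
  have key : ∀ (A B C : GPA k Γ) (r : Γ.Path ((A.seq ++ B.seq) ++ C.seq))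
      (r' : Γ.Path (A.seq ++ (B.seq ++ C.seq))), r.src = r'.src → r.rest = r'.rest →
      (r.left (A.seq ++ B.seq) C.seq).left A.seq B.seq = r'.left A.seq (B.seq ++ C.seq) ∧
      (r.left (A.seq ++ B.seq) C.seq).right A.seq B.seq =
        (r'.right A.seq (B.seq ++ C.seq)).left B.seq C.seq ∧
      r.right (A.seq ++ B.seq) C.seq = (r'.right A.seq (B.seq ++ C.seq)).right B.seq C.seq := by
    rintro A B C ⟨x, vs, hv⟩ ⟨x', vs', hv'⟩ rfl rfl
    have h1 : (LabeledGraph.Path.left (A.seq ++ B.seq) C.seq ⟨x, vs, hv⟩).left A.seq B.seq =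
        LabeledGraph.Path.left A.seq (B.seq ++ C.seq) ⟨x, vs, hv'⟩ := by
      ext1
      · rfl
      · simp [LabeledGraph.Path.left, List.take_take]
    have h2 : (LabeledGraph.Path.left (A.seq ++ B.seq) C.seq ⟨x, vs, hv⟩).right A.seq B.seq =
        (LabeledGraph.Path.right A.seq (B.seq ++ C.seq) ⟨x, vs, hv'⟩).left B.seq C.seq := by
      ext1
      · exact congrArg LabeledGraph.Path.tgt h1
      · simp [LabeledGraph.Path.left, LabeledGraph.Path.right, List.drop_take]
    refine ⟨h1, h2, ?_⟩
    ext1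
    · have := congrArg LabeledGraph.Path.tgt h2
      rw [LabeledGraph.Path.tgt_right] at this
      exact this
    · simp [LabeledGraph.Path.right, List.drop_drop]
  obtain ⟨hp1, hp2, hp3⟩ := key X Y Z p (castPath (congrArg seq (tensorObj_assoc X Y Z)) p) rfl rfl
  obtain ⟨hq1, hq2, hq3⟩ := key X' Y' Z'
    (castPath (congrArg seq (tensorObj_assoc X' Y' Z').symm) q) q rfl rfl
  simp only [tensorHom, tensorObj] at hp1 hp2 hp3 hq1 hq2 hq3 ⊢
  rw [hp1, hp2, hp3, hq1, hq2, hq3, mul_assoc]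

theorem id_nil_toFun (p q : Γ.Path (⟨[]⟩ : GPA k Γ).seq) (h : p.src = q.src) :
    Hom.toFun (𝟙 (⟨[]⟩ : GPA k Γ)) p q = 1 := by
  refine if_pos (LabeledGraph.Path.ext h ?_)
  rw [List.eq_nil_of_length_eq_zero p.isWalk.length_eq,
    List.eq_nil_of_length_eq_zero q.isWalk.length_eq]

theorem tensorHom_unit_right {X Y : GPA k Γ} (f : X ⟶ Y) :
    tensorHom f (𝟙 (⟨[]⟩ : GPA k Γ)) ≫ eqToHom (tensorObj_nil Y) =
      eqToHom (tensorObj_nil X) ≫ f := by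
  apply hom_ext
  intro p q
  rw [comp_eqToHom_toFun, eqToHom_comp_toFun]
  have key : ∀ (A : GPA k Γ) (r : Γ.Path (A.seq ++ [])) (r' : Γ.Path A.seq), r.src = r'.src →
      r.rest = r'.rest → r.left A.seq [] = r' := by
    rintro A ⟨x, vs, hv⟩ ⟨x', vs', hv'⟩ rfl rfl
    ext1
    · rfl
    · simp [LabeledGraph.Path.left, ← hv'.length_eq]
  have hp := key X p (castPath (congrArg seq (tensorObj_nil X)) p) rfl rfl
  have hq := key Y (castPath (congrArg seq (tensorObj_nil Y).symm) q) q rfl rfl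
  simp only [tensorHom]
  by_cases h : (p.left X.seq []).Matched
      ((castPath (congrArg seq (tensorObj_nil Y).symm) q).left Y.seq [])
  · exact (congrArg₂ (· * ·) (congrArg₂ f.toFun hp hq) (id_nil_toFun _ _ h.2)).trans (mul_one _)
  · refine (congrArg (· * _) (f.vanish _ _ h)).trans ((zero_mul _).trans ?_)
    exact ((congrArg₂ f.toFun hp hq).symm.trans (f.vanish _ _ h)).symm

theorem tensorHom_unit_left {X Y : GPA k Γ} (f : X ⟶ Y) :
    tensorHom (𝟙 (⟨[]⟩ : GPA k Γ)) f ≫ eqToHom (nil_tensorObj Y) =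
      eqToHom (nil_tensorObj X) ≫ f := by
  refine (Category.comp_id _).trans (Eq.trans ?_ (Category.id_comp _).symm)
  apply hom_ext
  intro p q
  change Hom.toFun (𝟙 (⟨[]⟩ : GPA k Γ)) _ _ * f.toFun p q = f.toFun p q
  by_cases h : p.src = q.src
  · rw [id_nil_toFun _ _ (by exact h), one_mul]
  · rw [f.vanish p q fun h' => h h'.1, mul_zero]

theorem pentagon_aux (W X Y Z : GPA k Γ) :
    tensorHom (eqToHom (tensorObj_assoc W X Y)) (𝟙 Z) ≫
        eqToHom (tensorObj_assoc W (tensorObj X Y) Z) ≫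
          tensorHom (𝟙 W) (eqToHom (tensorObj_assoc X Y Z)) =
      eqToHom (tensorObj_assoc (tensorObj W X) Y Z) ≫
        eqToHom (tensorObj_assoc W X (tensorObj Y Z)) := by
  rw [← eqToHom_refl Z rfl, ← eqToHom_refl W rfl]
  simp only [tensorHom_eqToHom, eqToHom_trans]

theorem triangle_aux (X Y : GPA k Γ) :
    eqToHom (tensorObj_assoc X ⟨[]⟩ Y) ≫ tensorHom (𝟙 X) (eqToHom (nil_tensorObj Y)) =
      tensorHom (eqToHom (tensorObj_nil X)) (𝟙 Y) := by
  rw [← eqToHom_refl Y rfl, ← eqToHom_refl X rfl]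
  simp only [tensorHom_eqToHom, eqToHom_trans]

noncomputable instance : MonoidalCategoryStruct (GPA k Γ) where
  tensorObj := tensorObj
  tensorHom := tensorHom
  whiskerLeft X _ _ f := tensorHom (𝟙 X) f
  whiskerRight f Y := tensorHom f (𝟙 Y)
  tensorUnit := ⟨[]⟩
  associator X Y Z := eqToIso (tensorObj_assoc X Y Z)
  leftUnitor X := eqToIso (nil_tensorObj X)
  rightUnitor X := eqToIso (tensorObj_nil X)

noncomputable instance : MonoidalCategory (GPA k Γ) :=
  MonoidalCategory.ofTensorHom
    (id_tensorHom_id := tensorHom_id)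
    (id_tensorHom := fun _ _ _ _ => rfl)
    (tensorHom_id := fun _ _ => rfl)
    (tensorHom_comp_tensorHom := fun f g h i => (tensorHom_comp f h g i).symm)
    (associator_naturality := tensorHom_assoc)
    (leftUnitor_naturality := tensorHom_unit_left)
    (rightUnitor_naturality := tensorHom_unit_right)
    (pentagon := pentagon_aux)
    (triangle := triangle_aux)

open Classical in
/-- The triangle indicator map between two objects: it takes the value `1` on a matched pair of
paths whose concatenation is a cycle, and `0` on all other pairs. -/
noncomputable def triangle (X Y : GPA k Γ) : X ⟶ Y where
  toFun p q := if p.BoundsCycle q then 1 else 0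
  vanish _ _ h := if_neg fun h' => h h'.1

end GPA

/-! ## The weight lattice of `sl_n` as a labelled graph -/

/-- The weight lattice of `sl_n`: the free abelian group on `L_1, …, L_n` modulo
`L_1 + ⋯ + L_n`. -/
abbrev WeightLattice (n : ℕ) : Type :=
  (Fin n → ℤ) ⧸ AddSubgroup.zmultiples (fun _ : Fin n => (1 : ℤ))

/-- The weight `∑_{i ∈ A} L_i` attached to a subset `A` of `{1, …, n}`. -/
def subsetWeight (n : ℕ) (A : Finset (Fin n)) : WeightLattice n :=
  QuotientAddGroup.mk' _ (∑ i ∈ A, Pi.single i 1)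

/-- The possible edge labels `1, …, n - 1`. -/
abbrev EdgeLabel (n : ℕ) : Type := {a : ℕ // 1 ≤ a ∧ a < n}

/-- The `sl_n` weight lattice as a labelled graph: there is an edge from `x` to `y` labelled `l`
if `y = x + ∑_{i ∈ A} L_i` for a (nonempty proper) subset `A` of `{1, …, n}` with `l` elements. -/
def weightGraph (n : ℕ) : LabeledGraph (WeightLattice n) (EdgeLabel n) where
  Edge x y l := ∃ A : Finset (Fin n), A.card = l.1 ∧ y = x + subsetWeight n A
  locallyFinite x l := by
    refine (Set.finite_range fun A : Finset (Fin n) => x + subsetWeight n A).subset ?_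
    rintro y ⟨A, -, rfl⟩
    exact ⟨A, rfl⟩

/-! ## The category `Web(SL_n^-)` -/

/-- The labels `1, …, n` of the strands of a web. -/
abbrev WebLabel (n : ℕ) : Type := {a : ℕ // 1 ≤ a ∧ a ≤ n}

/-- The sum of two strand labels. -/
def WebLabel.add {n : ℕ} (i j : WebLabel n) (h : i.1 + j.1 ≤ n) : WebLabel n :=
  ⟨i.1 + j.1, i.2.1.trans (Nat.le_add_right _ _), h⟩

theorem WebLabel.add_add {n : ℕ} (i j l : WebLabel n) (h : i.1 + j.1 + l.1 ≤ n) :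
    i.add (j.add l (by omega)) ((Nat.add_assoc _ _ _).symm.trans_le h) =
      (i.add j (by omega)).add l h :=
  Subtype.ext (Nat.add_assoc _ _ _).symm

/-- The largest strand label, `n`. -/
def WebLabel.top {n : ℕ} (hn : 1 ≤ n) : WebLabel n := ⟨n, hn, le_rfl⟩

theorem WebLabel.add_eq_top {n : ℕ} (i j : WebLabel n) (h : i.1 + j.1 = n) :
    i.add j h.le = WebLabel.top (i.2.1.trans i.2.2) := Subtype.ext h

/-- Formal `k`-linear combinations of horizontal composites (`tensor`) and vertical composites
(`comp`, read from bottom to top) of the generating webs: the trivalent vertices `merge` and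
`split` and the univalent vertices `dot` (an `n`-strand ending at the top) and `codot`
(an `n`-strand starting at the bottom). -/
inductive PreWeb (k : Type u) (n : ℕ) : List (WebLabel n) → List (WebLabel n) → Type u
  | id (a : List (WebLabel n)) : PreWeb k n a a
  | comp {a b c : List (WebLabel n)} (f : PreWeb k n a b) (g : PreWeb k n b c) : PreWeb k n a c
  | tensor {a b c d : List (WebLabel n)} (f : PreWeb k n a b) (g : PreWeb k n c d) :
      PreWeb k n (a ++ c) (b ++ d)
  | zero {a b : List (WebLabel n)} : PreWeb k n a b
  | add {a b : List (WebLabel n)} (f g : PreWeb k n a b) : PreWeb k n a b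
  | smul {a b : List (WebLabel n)} (r : k) (f : PreWeb k n a b) : PreWeb k n a b
  | merge (i j : WebLabel n) (h : i.1 + j.1 ≤ n) : PreWeb k n [i, j] [i.add j h]
  | split (i j : WebLabel n) (h : i.1 + j.1 ≤ n) : PreWeb k n [i.add j h] [i, j]
  | dot (hn : 1 ≤ n) : PreWeb k n [WebLabel.top hn] []
  | codot (hn : 1 ≤ n) : PreWeb k n [] [WebLabel.top hn]

namespace PreWeb

variable {k : Type u} {n : ℕ}

/-- Transport along equalities of source and target. -/
def cast {a b a' b' : List (WebLabel n)} (h : a = a') (h' : b = b') (f : PreWeb k n a b) :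
    PreWeb k n a' b' :=
  h ▸ h' ▸ f

/-- The sum `f 0 + ⋯ + f (N - 1)`. -/
def sum {a b : List (WebLabel n)} (f : ℕ → PreWeb k n a b) : ℕ → PreWeb k n a b
  | 0 => zero
  | N + 1 => add (sum f N) (f N)

/-- The object given by a single strand labelled `a`, where a strand labelled `0` is no strand.
(The value for `a > n` is irrelevant: webs with such a strand are zero.) -/
def strand (n a : ℕ) : List (WebLabel n) := if h : 1 ≤ a ∧ a ≤ n then [⟨a, h⟩] else []

theorem strand_zero (n : ℕ) : strand n 0 = [] := dif_neg (by simp)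

theorem strand_of_pos {a : ℕ} (h : a ≠ 0) (h' : a ≤ n) :
    strand n a = [⟨a, Nat.one_le_iff_ne_zero.2 h, h'⟩] :=
  dif_pos ⟨Nat.one_le_iff_ne_zero.2 h, h'⟩

theorem strand_add_of_eq_zero_left {a : ℕ} (b : ℕ) (h : a = 0) :
    strand n (a + b) = strand n a ++ strand n b := by
  rw [h, strand_zero, zero_add, List.nil_append]

theorem strand_add_of_eq_zero_right (a : ℕ) {b : ℕ} (h : b = 0) :
    strand n (a + b) = strand n a ++ strand n b := by
  rw [h, strand_zero, add_zero, List.append_nil]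

theorem strand_append {a b : ℕ} (ha : a ≠ 0) (hb : b ≠ 0) (h : a + b ≤ n) :
    [(⟨a, Nat.one_le_iff_ne_zero.2 ha, (Nat.le_add_right a b).trans h⟩ : WebLabel n),
      ⟨b, Nat.one_le_iff_ne_zero.2 hb, (Nat.le_add_left b a).trans h⟩] =
      strand n a ++ strand n b := by
  rw [strand_of_pos ha ((Nat.le_add_right a b).trans h),
    strand_of_pos hb ((Nat.le_add_left b a).trans h), List.singleton_append]

theorem strand_add {a b : ℕ} (ha : a ≠ 0) (hb : b ≠ 0) (h : a + b ≤ n) :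
    [WebLabel.add (⟨a, Nat.one_le_iff_ne_zero.2 ha, (Nat.le_add_right a b).trans h⟩ : WebLabel n)
      ⟨b, Nat.one_le_iff_ne_zero.2 hb, (Nat.le_add_left b a).trans h⟩ h] = strand n (a + b) :=
  (strand_of_pos (fun h0 => ha (Nat.eq_zero_of_add_eq_zero_right h0)) h).symm

/-- The merge vertex with arbitrary natural numbers as labels: it is zero if the label `a + b`
exceeds `n`, and an identity if `a` or `b` is zero. -/
def mergeNat (k : Type u) (n a b : ℕ) : PreWeb k n (strand n a ++ strand n b) (strand n (a + b)) :=
  if h : a + b ≤ n then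
    if ha : a = 0 then cast (strand_add_of_eq_zero_left b ha) rfl (id _)
    else if hb : b = 0 then cast (strand_add_of_eq_zero_right a hb) rfl (id _)
    else cast (strand_append ha hb h) (strand_add ha hb h) (merge _ _ h)
  else zero

/-- The split vertex with arbitrary natural numbers as labels: it is zero if the label `a + b`
exceeds `n`, and an identity if `a` or `b` is zero. -/
def splitNat (k : Type u) (n a b : ℕ) : PreWeb k n (strand n (a + b)) (strand n a ++ strand n b) :=
  if h : a + b ≤ n then
    if ha : a = 0 then cast rfl (strand_add_of_eq_zero_left b ha) (id _)
    else if hb : b = 0 then cast rfl (strand_add_of_eq_zero_right a hb) (id _)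
    else cast (strand_add ha hb h) (strand_append ha hb h) (split _ _ h)
  else zero

/-- Two uprights, labelled `m` and `l` at the bottom and `m'` and `l'` at the top, joined by a rung
labelled `r` that ascends from the left upright to the right one. There is such a web only if
`m = m' + r` and `l' = r + l`; otherwise the value is zero. -/
def rungRight (k : Type u) (n m l m' l' r : ℕ) :
    PreWeb k n (strand n m ++ strand n l) (strand n m' ++ strand n l') :=
  if h : m = m' + r ∧ l' = r + l then
    cast (by rw [h.1]) (by rw [h.2])
      (comp (cast rfl (List.append_assoc _ _ _) (tensor (splitNat k n m' r) (id (strand n l))))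
        (tensor (id (strand n m')) (mergeNat k n r l)))
  else zero

/-- Two uprights, labelled `m` and `l` at the bottom and `m'` and `l'` at the top, joined by a rung
labelled `r` that ascends from the right upright to the left one. There is such a web only if
`l = r + l'` and `m' = m + r`; otherwise the value is zero. -/
def rungLeft (k : Type u) (n m l m' l' r : ℕ) :
    PreWeb k n (strand n m ++ strand n l) (strand n m' ++ strand n l') :=
  if h : l = r + l' ∧ m' = m + r then
    cast (by rw [h.1]) (by rw [h.2])
      (comp (tensor (id (strand n m)) (splitNat k n r l'))
        (cast (List.append_assoc _ _ _) rfl (tensor (mergeNat k n m r) (id (strand n l')))))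
  else zero

/-- A merge of `i` and `n - i`, followed by the univalent vertex. -/
def cap (k : Type u) {n : ℕ} (i j : WebLabel n) (h : i.1 + j.1 = n) : PreWeb k n [i, j] [] :=
  comp (merge i j h.le)
    (cast (by rw [WebLabel.add_eq_top i j h]) rfl (dot (i.2.1.trans i.2.2)))

/-- The univalent vertex, followed by a split into `i` and `n - i`. -/
def cup (k : Type u) {n : ℕ} (i j : WebLabel n) (h : i.1 + j.1 = n) : PreWeb k n [] [i, j] :=
  comp (codot (i.2.1.trans i.2.2))
    (cast (by rw [WebLabel.add_eq_top i j h]) rfl (split i j h.le))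

/-- The generalized binomial coefficient `x (x - 1) ⋯ (x - t + 1) / t!` of an integer `x`, as an
element of `k`. -/
def binom (k : Type u) [Field k] (x : ℤ) (t : ℕ) : k := ((Ring.choose x t : ℤ) : k)

end PreWeb

open PreWeb in
/-- The defining relations of `Web(SL_n^-)`. -/
inductive WebRel (k : Type u) [Field k] (n : ℕ) :
    ∀ {a b : List (WebLabel n)}, PreWeb k n a b → PreWeb k n a b → Prop
  /-- Associativity. -/
  | merge_assoc (i j l : WebLabel n) (h : i.1 + j.1 + l.1 ≤ n) :
      WebRel k n
        (comp (tensor (merge i j (by omega)) (id [l]) : PreWeb k n [i, j, l] [i.add j (by omega), l])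
          (merge (i.add j (by omega)) l h))
        (comp (tensor (id [i]) (merge j l (by omega)) : PreWeb k n [i, j, l] [i, j.add l (by omega)])
          (cast rfl (by rw [WebLabel.add_add i j l h])
            (merge i (j.add l (by omega)) ((Nat.add_assoc _ _ _).symm.trans_le h))))
  /-- Coassociativity. -/
  | split_assoc (i j l : WebLabel n) (h : i.1 + j.1 + l.1 ≤ n) :
      WebRel k n
        (comp (split (i.add j (by omega)) l h)
          (tensor (split i j (by omega)) (id [l]) : PreWeb k n [i.add j (by omega), l] [i, j, l]))
        (comp (cast (by rw [WebLabel.add_add i j l h]) rfl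
            (split i (j.add l (by omega)) ((Nat.add_assoc _ _ _).symm.trans_le h)))
          (tensor (id [i]) (split j l (by omega)) : PreWeb k n [i, j.add l (by omega)] [i, j, l]))
  /-- Bigon bursting. -/
  | bigon (i j : WebLabel n) (h : i.1 + j.1 ≤ n) :
      WebRel k n (comp (split i j h) (merge i j h))
        (smul ((i.1 + j.1).choose i.1 : k) (id [i.add j h]))
  /-- The first square switch relation. -/
  | square_switch_right (m l m' l' i j : ℕ) (hm : m ≤ n) (hl : l ≤ n) (hm' : m' ≤ n) (hl' : l' ≤ n)
      (h₁ : m + i = m' + j) (h₂ : l + j = l' + i) :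
      WebRel k n
        (comp (rungRight k n m l (m - j) (l + j) j) (rungLeft k n (m - j) (l + j) m' l' i))
        (sum (fun t => smul (binom k ((m : ℤ) - l + i - j) t)
          (comp (rungLeft k n m l (m + (i - t)) (l - (i - t)) (i - t))
            (rungRight k n (m + (i - t)) (l - (i - t)) m' l' (j - t)))) (min i j + 1))
  /-- The second square switch relation. -/
  | square_switch_left (m l m' l' i j : ℕ) (hm : m ≤ n) (hl : l ≤ n) (hm' : m' ≤ n) (hl' : l' ≤ n)
      (h₁ : m + j = m' + i) (h₂ : l + i = l' + j) :
      WebRel k n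
        (comp (rungLeft k n m l (m + j) (l - j) j) (rungRight k n (m + j) (l - j) m' l' i))
        (sum (fun t => smul (binom k ((l : ℤ) - m + i - j) t)
          (comp (rungRight k n m l (m - (i - t)) (l + (i - t)) (i - t))
            (rungLeft k n (m - (i - t)) (l + (i - t)) m' l' (j - t)))) (min i j + 1))
  /-- A dotted strand and a codotted strand compose to the identity of `n` ... -/
  | dot_codot (hn : 1 ≤ n) : WebRel k n (comp (dot hn) (codot hn)) (id [WebLabel.top hn])
  /-- ... and to the empty web. -/
  | codot_dot (hn : 1 ≤ n) : WebRel k n (comp (codot hn) (dot hn)) (id [])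
  /-- The first `SL_n^-` relation. -/
  | snake_left (i j : WebLabel n) (h : i.1 + j.1 = n) (h' : j.1 + i.1 = n) :
      WebRel k n (id [i])
        (comp (tensor (id [i]) (cup k j i h') : PreWeb k n [i] [i, j, i])
          (tensor (cap k i j h) (id [i]) : PreWeb k n [i, j, i] [i]))
  /-- The second `SL_n^-` relation. -/
  | snake_right (i j : WebLabel n) (h : i.1 + j.1 = n) (h' : j.1 + i.1 = n) :
      WebRel k n (id [i])
        (comp (tensor (cup k i j h) (id [i]) : PreWeb k n [i] [i, j, i])
          (tensor (id [i]) (cap k j i h') : PreWeb k n [i, j, i] [i]))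

open PreWeb in
/-- The congruence generated by the defining relations and by the axioms of a `k`-linear strict
monoidal category. -/
inductive WebCong (k : Type u) [Field k] (n : ℕ) :
    ∀ {a b : List (WebLabel n)}, PreWeb k n a b → PreWeb k n a b → Prop
  | rel {a b} {f g : PreWeb k n a b} (h : WebRel k n f g) : WebCong k n f g
  | refl {a b} (f : PreWeb k n a b) : WebCong k n f f
  | symm {a b} {f g : PreWeb k n a b} (h : WebCong k n f g) : WebCong k n g f
  | trans {a b} {f g h : PreWeb k n a b} (h₁ : WebCong k n f g) (h₂ : WebCong k n g h) :
      WebCong k n f h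
  | comp_congr {a b c} {f f' : PreWeb k n a b} {g g' : PreWeb k n b c} (h₁ : WebCong k n f f')
      (h₂ : WebCong k n g g') : WebCong k n (comp f g) (comp f' g')
  | tensor_congr {a b c d} {f f' : PreWeb k n a b} {g g' : PreWeb k n c d}
      (h₁ : WebCong k n f f') (h₂ : WebCong k n g g') : WebCong k n (tensor f g) (tensor f' g')
  | add_congr {a b} {f f' g g' : PreWeb k n a b} (h₁ : WebCong k n f f')
      (h₂ : WebCong k n g g') : WebCong k n (add f g) (add f' g')
  | smul_congr {a b} (r : k) {f f' : PreWeb k n a b} (h : WebCong k n f f') :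
      WebCong k n (smul r f) (smul r f')
  | id_comp {a b} (f : PreWeb k n a b) : WebCong k n (comp (id a) f) f
  | comp_id {a b} (f : PreWeb k n a b) : WebCong k n (comp f (id b)) f
  | comp_assoc {a b c d} (f : PreWeb k n a b) (g : PreWeb k n b c) (h : PreWeb k n c d) :
      WebCong k n (comp (comp f g) h) (comp f (comp g h))
  | add_assoc {a b} (f g h : PreWeb k n a b) :
      WebCong k n (add (add f g) h) (add f (add g h))
  | add_comm {a b} (f g : PreWeb k n a b) : WebCong k n (add f g) (add g f)
  | zero_add {a b} (f : PreWeb k n a b) : WebCong k n (add zero f) f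
  | zero_smul {a b} (f : PreWeb k n a b) : WebCong k n (smul 0 f) zero
  | one_smul {a b} (f : PreWeb k n a b) : WebCong k n (smul 1 f) f
  | mul_smul {a b} (r s : k) (f : PreWeb k n a b) :
      WebCong k n (smul (r * s) f) (smul r (smul s f))
  | add_smul {a b} (r s : k) (f : PreWeb k n a b) :
      WebCong k n (smul (r + s) f) (add (smul r f) (smul s f))
  | smul_add {a b} (r : k) (f g : PreWeb k n a b) :
      WebCong k n (smul r (add f g)) (add (smul r f) (smul r g))
  | add_comp {a b c} (f f' : PreWeb k n a b) (g : PreWeb k n b c) :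
      WebCong k n (comp (add f f') g) (add (comp f g) (comp f' g))
  | comp_add {a b c} (f : PreWeb k n a b) (g g' : PreWeb k n b c) :
      WebCong k n (comp f (add g g')) (add (comp f g) (comp f g'))
  | smul_comp {a b c} (r : k) (f : PreWeb k n a b) (g : PreWeb k n b c) :
      WebCong k n (comp (smul r f) g) (smul r (comp f g))
  | comp_smul {a b c} (r : k) (f : PreWeb k n a b) (g : PreWeb k n b c) :
      WebCong k n (comp f (smul r g)) (smul r (comp f g))
  | add_tensor {a b c d} (f f' : PreWeb k n a b) (g : PreWeb k n c d) :
      WebCong k n (tensor (add f f') g) (add (tensor f g) (tensor f' g))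
  | tensor_add {a b c d} (f : PreWeb k n a b) (g g' : PreWeb k n c d) :
      WebCong k n (tensor f (add g g')) (add (tensor f g) (tensor f g'))
  | smul_tensor {a b c d} (r : k) (f : PreWeb k n a b) (g : PreWeb k n c d) :
      WebCong k n (tensor (smul r f) g) (smul r (tensor f g))
  | tensor_smul {a b c d} (r : k) (f : PreWeb k n a b) (g : PreWeb k n c d) :
      WebCong k n (tensor f (smul r g)) (smul r (tensor f g))
  | tensor_id (a b : List (WebLabel n)) : WebCong k n (tensor (id a) (id b)) (id (a ++ b))
  | interchange {a b c a' b' c'} (f : PreWeb k n a b) (g : PreWeb k n b c)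
      (f' : PreWeb k n a' b') (g' : PreWeb k n b' c') :
      WebCong k n (tensor (comp f g) (comp f' g')) (comp (tensor f f') (tensor g g'))
  | tensor_assoc {a b c a' b' c'} (f : PreWeb k n a a') (g : PreWeb k n b b')
      (h : PreWeb k n c c') :
      WebCong k n (cast (List.append_assoc a b c) (List.append_assoc a' b' c')
        (tensor (tensor f g) h)) (tensor f (tensor g h))
  | id_nil_tensor {a b} (f : PreWeb k n a b) : WebCong k n (tensor (id []) f) f
  | tensor_id_nil {a b} (f : PreWeb k n a b) :
      WebCong k n (cast (List.append_nil a) (List.append_nil b) (tensor f (id []))) f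

/-- The category `Web(SL_n^-)` over the field `k`: its objects are finite sequences in
`{1, …, n}`. -/
@[ext]
structure Web (k : Type u) (n : ℕ) where
  seq : List (WebLabel n)

namespace Web

variable {k : Type u} {n : ℕ}

/-- The tensor product of two objects: concatenation of sequences. -/
def tensorObj (X Y : Web k n) : Web k n := ⟨X.seq ++ Y.seq⟩

theorem tensorObj_assoc (X Y Z : Web k n) :
    tensorObj (tensorObj X Y) Z = tensorObj X (tensorObj Y Z) :=
  congrArg mk (List.append_assoc _ _ _)

theorem tensorObj_nil (X : Web k n) : tensorObj X ⟨[]⟩ = X :=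
  congrArg mk (List.append_nil _)

theorem nil_tensorObj (X : Web k n) : tensorObj ⟨[]⟩ X = X := rfl

variable [Field k]

/-- Two formal webs are identified if they are congruent. -/
def setoid (a b : List (WebLabel n)) : Setoid (PreWeb k n a b) where
  r := WebCong k n
  iseqv := ⟨WebCong.refl, WebCong.symm, WebCong.trans⟩

/-- Morphisms of `Web(SL_n^-)`. -/
def Hom (X Y : Web k n) : Type u := Quotient (setoid (k := k) X.seq Y.seq)

instance : Category (Web k n) where
  Hom := Hom
  id X := Quotient.mk _ (.id X.seq)
  comp := Quotient.map₂ .comp fun _ _ h _ _ h' => .comp_congr h h'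
  id_comp f := Quotient.inductionOn f fun f => Quotient.sound (.id_comp f)
  comp_id f := Quotient.inductionOn f fun f => Quotient.sound (.comp_id f)
  assoc f g h := Quotient.inductionOn₃ f g h fun f g h => Quotient.sound (.comp_assoc f g h)

/-- The morphism represented by a formal web. -/
def ofPreWeb {a b : List (WebLabel n)} (f : PreWeb k n a b) : (⟨a⟩ : Web k n) ⟶ ⟨b⟩ :=
  Quotient.mk _ f

theorem ofPreWeb_eq {a b : List (WebLabel n)} {f g : PreWeb k n a b} (h : WebCong k n f g) :
    ofPreWeb f = ofPreWeb g := Quotient.sound h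

theorem ofPreWeb_surjective {X Y : Web k n} (f : X ⟶ Y) :
    ∃ f' : PreWeb k n X.seq Y.seq, ofPreWeb f' = f := Quotient.exists_rep f

theorem ofPreWeb_cast {a b a' b' : List (WebLabel n)} (h : a = a') (h' : b = b')
    (f : PreWeb k n a b) :
    ofPreWeb (f.cast h h') =
      eqToHom (congrArg mk h.symm) ≫ ofPreWeb f ≫ eqToHom (congrArg mk h') := by
  subst h h'
  simp [PreWeb.cast]

/-! ### The linear structure -/

instance (X Y : Web k n) : Zero (X ⟶ Y) := ⟨ofPreWeb .zero⟩
instance (X Y : Web k n) : Add (X ⟶ Y) :=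
  ⟨Quotient.map₂ .add fun _ _ h _ _ h' => .add_congr h h'⟩
instance (X Y : Web k n) : SMul k (X ⟶ Y) :=
  ⟨fun r => Quotient.map (.smul r) fun _ _ h => .smul_congr r h⟩

protected theorem add_assoc {X Y : Web k n} (f g h : X ⟶ Y) : f + g + h = f + (g + h) :=
  Quotient.inductionOn₃ f g h fun f g h => Quotient.sound (.add_assoc f g h)
protected theorem add_comm {X Y : Web k n} (f g : X ⟶ Y) : f + g = g + f :=
  Quotient.inductionOn₂ f g fun f g => Quotient.sound (.add_comm f g)
protected theorem zero_add {X Y : Web k n} (f : X ⟶ Y) : 0 + f = f :=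
  Quotient.inductionOn f fun f => Quotient.sound (.zero_add f)
protected theorem zero_smul {X Y : Web k n} (f : X ⟶ Y) : (0 : k) • f = 0 :=
  Quotient.inductionOn f fun f => Quotient.sound (.zero_smul f)
protected theorem one_smul {X Y : Web k n} (f : X ⟶ Y) : (1 : k) • f = f :=
  Quotient.inductionOn f fun f => Quotient.sound (.one_smul f)
protected theorem mul_smul {X Y : Web k n} (r s : k) (f : X ⟶ Y) : (r * s) • f = r • s • f :=
  Quotient.inductionOn f fun f => Quotient.sound (.mul_smul r s f)
protected theorem add_smul {X Y : Web k n} (r s : k) (f : X ⟶ Y) : (r + s) • f = r • f + s • f :=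
  Quotient.inductionOn f fun f => Quotient.sound (.add_smul r s f)
protected theorem smul_add {X Y : Web k n} (r : k) (f g : X ⟶ Y) : r • (f + g) = r • f + r • g :=
  Quotient.inductionOn₂ f g fun f g => Quotient.sound (.smul_add r f g)

instance (X Y : Web k n) : Neg (X ⟶ Y) := ⟨fun f => (-1 : k) • f⟩

instance (X Y : Web k n) : AddCommGroup (X ⟶ Y) where
  add_assoc := Web.add_assoc
  zero_add := Web.zero_add
  add_zero f := by rw [Web.add_comm, Web.zero_add]
  add_comm := Web.add_comm
  neg_add_cancel f := by
    change (-1 : k) • f + f = 0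
    conv_lhs => rw [← Web.one_smul f, ← Web.mul_smul, ← Web.add_smul]
    rw [mul_one, neg_add_cancel, Web.zero_smul]
  nsmul := nsmulRec
  zsmul := zsmulRec

instance (X Y : Web k n) : Module k (X ⟶ Y) :=
  Module.ofMinimalAxioms Web.smul_add Web.add_smul Web.mul_smul Web.one_smul

protected theorem add_comp {X Y Z : Web k n} (f f' : X ⟶ Y) (g : Y ⟶ Z) :
    (f + f') ≫ g = f ≫ g + f' ≫ g :=
  Quotient.inductionOn₃ f f' g fun f f' g => Quotient.sound (.add_comp f f' g)
protected theorem comp_add {X Y Z : Web k n} (f : X ⟶ Y) (g g' : Y ⟶ Z) :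
    f ≫ (g + g') = f ≫ g + f ≫ g' :=
  Quotient.inductionOn₃ f g g' fun f g g' => Quotient.sound (.comp_add f g g')
protected theorem smul_comp {X Y Z : Web k n} (r : k) (f : X ⟶ Y) (g : Y ⟶ Z) :
    (r • f) ≫ g = r • (f ≫ g) :=
  Quotient.inductionOn₂ f g fun f g => Quotient.sound (.smul_comp r f g)
protected theorem comp_smul {X Y Z : Web k n} (f : X ⟶ Y) (r : k) (g : Y ⟶ Z) :
    f ≫ (r • g) = r • (f ≫ g) :=
  Quotient.inductionOn₂ f g fun f g => Quotient.sound (.comp_smul r f g)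

instance : Preadditive (Web k n) where
  add_comp _ _ _ := Web.add_comp
  comp_add _ _ _ := Web.comp_add

instance : Linear k (Web k n) where
  smul_comp _ _ _ := Web.smul_comp
  comp_smul _ _ _ := Web.comp_smul

/-! ### The monoidal structure -/

/-- The tensor product of two morphisms: horizontal composition. -/
def tensorHom {X Y X' Y' : Web k n} (f : X ⟶ Y) (g : X' ⟶ Y') :
    tensorObj X X' ⟶ tensorObj Y Y' :=
  Quotient.map₂ .tensor (fun _ _ h _ _ h' => .tensor_congr h h') f g

theorem tensorHom_id (X Y : Web k n) : tensorHom (𝟙 X) (𝟙 Y) = 𝟙 (tensorObj X Y) :=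
  Quotient.sound (.tensor_id X.seq Y.seq)

theorem tensorHom_comp {X Y Z X' Y' Z' : Web k n} (f : X ⟶ Y) (g : Y ⟶ Z) (f' : X' ⟶ Y')
    (g' : Y' ⟶ Z') : tensorHom (f ≫ g) (f' ≫ g') = tensorHom f f' ≫ tensorHom g g' :=
  Quotient.inductionOn₂ f g fun f g => Quotient.inductionOn₂ f' g' fun f' g' =>
    Quotient.sound (.interchange f g f' g')

theorem tensorHom_eqToHom {X Y X' Y' : Web k n} (h : X = Y) (h' : X' = Y') :
    tensorHom (eqToHom h) (eqToHom h') = eqToHom (by rw [h, h']) := by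
  subst h h'
  exact tensorHom_id _ _

theorem comp_eqToHom_of_cast {a b a' b' : List (WebLabel n)} (h : a = a') (h' : b = b')
    {f : PreWeb k n a b} {g : PreWeb k n a' b'} (hfg : WebCong k n (f.cast h h') g) :
    ofPreWeb f ≫ eqToHom (congrArg mk h') = eqToHom (congrArg mk h) ≫ ofPreWeb g := by
  subst h h'
  rw [← ofPreWeb_eq hfg]
  exact (Category.comp_id _).trans (Category.id_comp _).symm

theorem tensorHom_assoc {X Y Z X' Y' Z' : Web k n} (f : X ⟶ X') (g : Y ⟶ Y') (h : Z ⟶ Z') :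
    tensorHom (tensorHom f g) h ≫ eqToHom (tensorObj_assoc X' Y' Z') =
      eqToHom (tensorObj_assoc X Y Z) ≫ tensorHom f (tensorHom g h) :=
  Quotient.inductionOn₃ f g h fun f g h => comp_eqToHom_of_cast
    (List.append_assoc _ _ _) (List.append_assoc _ _ _) (.tensor_assoc f g h)

theorem tensorHom_unit_right {X Y : Web k n} (f : X ⟶ Y) :
    tensorHom f (𝟙 (⟨[]⟩ : Web k n)) ≫ eqToHom (tensorObj_nil Y) =
      eqToHom (tensorObj_nil X) ≫ f :=
  Quotient.inductionOn f fun f => comp_eqToHom_of_cast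
    (List.append_nil _) (List.append_nil _) (.tensor_id_nil f)

theorem tensorHom_unit_left {X Y : Web k n} (f : X ⟶ Y) :
    tensorHom (𝟙 (⟨[]⟩ : Web k n)) f ≫ eqToHom (nil_tensorObj Y) =
      eqToHom (nil_tensorObj X) ≫ f := by
  refine (Category.comp_id _).trans (Eq.trans ?_ (Category.id_comp _).symm)
  exact Quotient.inductionOn f fun f => Quotient.sound (.id_nil_tensor f)

theorem pentagon_aux (W X Y Z : Web k n) :
    tensorHom (eqToHom (tensorObj_assoc W X Y)) (𝟙 Z) ≫
        eqToHom (tensorObj_assoc W (tensorObj X Y) Z) ≫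
          tensorHom (𝟙 W) (eqToHom (tensorObj_assoc X Y Z)) =
      eqToHom (tensorObj_assoc (tensorObj W X) Y Z) ≫
        eqToHom (tensorObj_assoc W X (tensorObj Y Z)) := by
  rw [← eqToHom_refl Z rfl, ← eqToHom_refl W rfl]
  simp only [tensorHom_eqToHom, eqToHom_trans]

theorem triangle_aux (X Y : Web k n) :
    eqToHom (tensorObj_assoc X ⟨[]⟩ Y) ≫ tensorHom (𝟙 X) (eqToHom (nil_tensorObj Y)) =
      tensorHom (eqToHom (tensorObj_nil X)) (𝟙 Y) := by
  rw [← eqToHom_refl Y rfl, ← eqToHom_refl X rfl]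
  simp only [tensorHom_eqToHom, eqToHom_trans]

instance : MonoidalCategoryStruct (Web k n) where
  tensorObj := tensorObj
  tensorHom := tensorHom
  whiskerLeft X _ _ f := tensorHom (𝟙 X) f
  whiskerRight f Y := tensorHom f (𝟙 Y)
  tensorUnit := ⟨[]⟩
  associator X Y Z := eqToIso (tensorObj_assoc X Y Z)
  leftUnitor X := eqToIso (nil_tensorObj X)
  rightUnitor X := eqToIso (tensorObj_nil X)

instance : MonoidalCategory (Web k n) :=
  MonoidalCategory.ofTensorHom
    (id_tensorHom_id := tensorHom_id)
    (id_tensorHom := fun _ _ _ _ => rfl)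
    (tensorHom_id := fun _ _ => rfl)
    (tensorHom_comp_tensorHom := fun f g h i => (tensorHom_comp f h g i).symm)
    (associator_naturality := tensorHom_assoc)
    (leftUnitor_naturality := tensorHom_unit_left)
    (rightUnitor_naturality := tensorHom_unit_right)
    (pentagon := pentagon_aux)
    (triangle := triangle_aux)

end Web

/-! ## The assignment on objects -/

/-- Reduction modulo `n` of a sequence in `{1, …, n}`: the entries equal to `n`, for which the
weight lattice graph has no edges, are replaced by the empty sequence. -/
def reduceSeq {n : ℕ} (a : List (WebLabel n)) : List (EdgeLabel n) :=
  a.filterMap fun i => if h : i.1 < n then some ⟨i.1, i.2.1, h⟩ else none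

/-- The object of `G(Γ)`, for `Γ` the `sl_n` weight lattice, assigned to an object of
`Web(SL_n^-)`. -/
def Web.reduce {k : Type u} {n : ℕ} (X : Web k n) : GPA k (weightGraph n) := ⟨reduceSeq X.seq⟩

theorem Web.reduce_tensor {k : Type u} [Field k] {n : ℕ} (X Y : Web k n) :
    Web.reduce (MonoidalCategoryStruct.tensorObj X Y) =
      MonoidalCategoryStruct.tensorObj X.reduce Y.reduce :=
  congrArg GPA.mk List.filterMap_append

theorem Web.reduce_unit {k : Type u} [Field k] {n : ℕ} :
    Web.reduce (MonoidalCategoryStruct.tensorUnit (Web k n)) =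
      MonoidalCategoryStruct.tensorUnit (GPA k (weightGraph n)) := rfl

/-! ## Paths in the weight lattice as lists of subsets -/

section Walks

variable {n : ℕ}

/-! A step of the weight lattice graph is translation by the weight of a subset, so a path amounts
to a starting vertex and a list of subsets of prescribed sizes. The sizes `0` and `n` are admitted
too: the subset is then empty or full, its weight is zero, and the walk does not move. Thus erased
strands labelled `0` and strands labelled `n`, deleted by the functor, fit the same encoding. The
images of webs are invariant under translation, hence become matrices over `k` indexed by lists of
subsets (`Represents`); composition becomes matrix multiplication and the tensor product becomes
concatenation of lists.

Dividing by `L_1 + ⋯ + L_n` loses nothing once sizes are fixed: two lists with the same total weight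
and the same total size contain every element equally often (`coverCount_eq_of_weight_eq`).
Consequently the entry of a merge at `[A, B]`, `[C]` is `1` exactly when `A` and `B` are disjoint
with union `C`, and two pairs of subsets with matching end points and equal total size have the same
intersection and the same union. Two webs need only be compared on entries of equal weight
(`Represents.hom_eq`).

The relations are now counting statements. Both sides of associativity say that three subsets
partition a fourth. The bigon counts the subsets of given size of a set. In a snake the middle
strand must carry the complement of the outer one. In a square switch a rung moves elements from one
subset to the other, keeping intersection and union. From `(A, B)` to `(A', B')`, the first subset
`P` of the intermediate pair ranges over an interval, from `A ∩ B` to `A ∩ A'` on one side of the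
relation and from `A ∪ A'` to `A ∪ B` on the other; the second subset is then determined. Counting
each interval by a binomial coefficient turns the relation into the Chu–Vandermonde identity with an
integral upper argument (`choose_vandermonde`, `sum_moveMatrix_square`). It holds over the integers,
hence in every characteristic.

What remains is formal: evaluation of formal webs respects the congruence, and the structure
morphisms on both sides are transports along equalities of lists. -/

theorem subsetWeight_apply_aux (A : Finset (Fin n)) (i : Fin n) :
    (∑ j ∈ A, Pi.single j (1 : ℤ) : Fin n → ℤ) i = if i ∈ A then 1 else 0 := by
  simp [Finset.sum_apply, Pi.single_apply]

/-- The number of members of a list of subsets that contain `i`. -/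
def coverCount (s : List (Finset (Fin n))) (i : Fin n) : ℤ :=
  (s.map fun A => if i ∈ A then (1 : ℤ) else 0).sum

theorem sum_subsetWeight (s : List (Finset (Fin n))) :
    (s.map (subsetWeight n)).sum = QuotientAddGroup.mk' _ (coverCount s) := by
  induction s with
  | nil => rfl
  | cons A s ih =>
    rw [List.map_cons, List.sum_cons, ih, subsetWeight, ← map_add]
    congr 1
    ext i
    simp [coverCount]

theorem sum_coverCount (s : List (Finset (Fin n))) :
    ∑ i, coverCount s i = ((s.map Finset.card).sum : ℕ) := by
  induction s with
  | nil => simp [coverCount]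
  | cons A s ih =>
    have : ∀ i, coverCount (A :: s) i = (if i ∈ A then (1 : ℤ) else 0) + coverCount s i :=
      fun i => by simp [coverCount]
    simp only [this, Finset.sum_add_distrib, ih]
    simp

/-- Equality in the quotient means that the two counting functions differ by a constant `z`. Summing
over all coordinates and using the equal total sizes gives `n * z = 0`. -/
theorem coverCount_eq_of_weight_eq {s t : List (Finset (Fin n))}
    (h : (s.map (subsetWeight n)).sum = (t.map (subsetWeight n)).sum)
    (hc : (s.map Finset.card).sum = (t.map Finset.card).sum) : coverCount s = coverCount t := by
  rw [sum_subsetWeight, sum_subsetWeight, QuotientAddGroup.mk'_apply, QuotientAddGroup.mk'_apply,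
    QuotientAddGroup.eq, AddSubgroup.mem_zmultiples_iff] at h
  obtain ⟨z, hz⟩ := h
  have hz' : ∀ i, coverCount t i = coverCount s i + z := fun i => by
    have := congrFun hz i
    simp at this
    omega
  have hsum := sum_coverCount t
  simp only [hz', Finset.sum_add_distrib, sum_coverCount, hc] at hsum
  ext i
  have hz0 : z = 0 := by
    have hn : n ≠ 0 := fun h => by subst h; exact i.elim0
    simpa [hn] using hsum
  rw [hz', hz0, add_zero]

theorem subsetWeight_univ : subsetWeight n Finset.univ = 0 := by
  have h := sum_subsetWeight [(Finset.univ : Finset (Fin n))]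
  simp only [List.map_cons, List.map_nil, List.sum_cons, List.sum_nil, add_zero] at h
  rw [h, QuotientAddGroup.mk'_apply, QuotientAddGroup.eq_zero_iff]
  refine AddSubgroup.mem_zmultiples_iff.2 ⟨1, ?_⟩
  ext i
  simp [coverCount]

theorem subsetWeight_empty : subsetWeight n ∅ = 0 := by simp [subsetWeight]

theorem subsetWeight_eq_zero_of_not {A : Finset (Fin n)} (h : ¬ (1 ≤ A.card ∧ A.card < n)) :
    subsetWeight n A = 0 := by
  by_cases h0 : A = ∅
  · rw [h0, subsetWeight_empty]
  · have h1 : A = Finset.univ := by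
      rw [← Finset.card_eq_iff_eq_univ, Fintype.card_fin]
      have := A.card_le_univ
      rw [Fintype.card_fin] at this
      have := Finset.card_pos.2 (Finset.nonempty_iff_ne_empty.2 h0)
      omega
    rw [h1, subsetWeight_univ]

/-- A multiple of the all-ones vector is constant, whereas the indicator of a nonempty proper subset
takes both values. This is what keeps the vertices of a triangle distinct. -/
theorem subsetWeight_ne_zero {A : Finset (Fin n)} (h : 1 ≤ A.card ∧ A.card < n) :
    subsetWeight n A ≠ 0 := by
  intro h0
  rw [subsetWeight, QuotientAddGroup.mk'_apply, QuotientAddGroup.eq_zero_iff,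
    AddSubgroup.mem_zmultiples_iff] at h0
  obtain ⟨z, hz⟩ := h0
  have hz' : ∀ i, z = if i ∈ A then 1 else 0 := fun i => by
    have := congrFun hz i
    rw [subsetWeight_apply_aux] at this
    simpa using this
  obtain ⟨i, hi⟩ := Finset.card_pos.1 h.1
  obtain ⟨j, hj⟩ : ∃ j, j ∉ A := by
    by_contra! hA
    have := (Finset.eq_univ_iff_forall.2 hA)
    rw [this, Finset.card_univ, Fintype.card_fin] at h
    omega
  have h1 := hz' i
  have h2 := hz' j
  rw [if_pos hi] at h1
  rw [if_neg hj] at h2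
  omega

/-- The edge labels among the entries of a sequence of natural numbers. -/
def edgeLabels (n : ℕ) (c : List ℕ) : List (EdgeLabel n) :=
  c.filterMap fun a => if h : 1 ≤ a ∧ a < n then some ⟨a, h⟩ else none

theorem edgeLabels_append (c d : List ℕ) :
    edgeLabels n (c ++ d) = edgeLabels n c ++ edgeLabels n d := List.filterMap_append

theorem edgeLabels_cons_pos {a : ℕ} (h : 1 ≤ a ∧ a < n) (c : List ℕ) :
    edgeLabels n (a :: c) = ⟨a, h⟩ :: edgeLabels n c := by
  simp [edgeLabels, h]

theorem edgeLabels_cons_neg {a : ℕ} (h : ¬ (1 ≤ a ∧ a < n)) (c : List ℕ) :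
    edgeLabels n (a :: c) = edgeLabels n c := by
  simp [edgeLabels, h]

theorem reduceSeq_eq_edgeLabels (a : List (WebLabel n)) :
    reduceSeq a = edgeLabels n (a.map Subtype.val) := by
  induction a with
  | nil => rfl
  | cons i a ih =>
    by_cases h : i.1 < n
    · rw [List.map_cons, edgeLabels_cons_pos ⟨i.2.1, h⟩, ← ih]
      simp [reduceSeq, h]
    · rw [List.map_cons, edgeLabels_cons_neg (fun h' => h h'.2), ← ih]
      simp [reduceSeq, h]

theorem reduceSeq_strand (a : ℕ) : reduceSeq (PreWeb.strand n a) = edgeLabels n [a] := by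
  by_cases h : 1 ≤ a ∧ a ≤ n
  · rw [PreWeb.strand, dif_pos h, reduceSeq_eq_edgeLabels]
    rfl
  · rw [PreWeb.strand, dif_neg h, edgeLabels_cons_neg (by omega)]
    rfl

/-- The vertices visited after `x` by the walk whose steps are the weights of the members of a list
of subsets; the empty and the full set give no step. -/
def walkOf (x : WeightLattice n) : List (Finset (Fin n)) → List (WeightLattice n)
  | [] => []
  | A :: s => if 1 ≤ A.card ∧ A.card < n then
      (x + subsetWeight n A) :: walkOf (x + subsetWeight n A) s else walkOf x s

theorem walkOf_cons_pos {A : Finset (Fin n)} (h : 1 ≤ A.card ∧ A.card < n) (x : WeightLattice n)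
    (s : List (Finset (Fin n))) : walkOf x (A :: s) =
      (x + subsetWeight n A) :: walkOf (x + subsetWeight n A) s := if_pos h

theorem walkOf_cons_neg {A : Finset (Fin n)} (h : ¬ (1 ≤ A.card ∧ A.card < n))
    (x : WeightLattice n) (s : List (Finset (Fin n))) : walkOf x (A :: s) = walkOf x s := if_neg h

theorem isWalk_walkOf (s : List (Finset (Fin n))) : ∀ x : WeightLattice n,
    (weightGraph n).IsWalk x (edgeLabels n (s.map Finset.card)) (walkOf x s) := by
  induction s with
  | nil => exact fun _ => trivial
  | cons A s ih =>
    intro x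
    by_cases h : 1 ≤ A.card ∧ A.card < n
    · rw [List.map_cons, edgeLabels_cons_pos h, walkOf_cons_pos h]
      exact ⟨⟨A, rfl, rfl⟩, ih _⟩
    · rw [List.map_cons, edgeLabels_cons_neg h, walkOf_cons_neg h]
      exact ih x

/-- An entry `0` or `n` contributes no edge, and the subset to be inserted there is one of that
size. An entry above `n` would contribute no edge either, but no subset of that size exists; hence
the bound on `c`. -/
theorem exists_eq_walkOf {c : List ℕ} (hc : ∀ a ∈ c, a ≤ n) :
    ∀ {x : WeightLattice n} {vs : List (WeightLattice n)},
      (weightGraph n).IsWalk x (edgeLabels n c) vs →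
      ∃ s : List (Finset (Fin n)), s.map Finset.card = c ∧ vs = walkOf x s := by
  induction c with
  | nil =>
    rintro x (_ | ⟨y, ys⟩) h
    · exact ⟨[], rfl, rfl⟩
    · exact h.elim
  | cons a c ih =>
    intro x vs h
    have ih := @ih fun b hb => hc b (List.mem_cons_of_mem _ hb)
    by_cases ha : 1 ≤ a ∧ a < n
    · rw [edgeLabels_cons_pos ha] at h
      rcases vs with _ | ⟨y, ys⟩
      · exact h.elim
      obtain ⟨⟨A, hA, rfl⟩, h⟩ := h
      obtain ⟨s, hs, rfl⟩ := ih h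
      refine ⟨A :: s, by simp [hA, hs], ?_⟩
      rw [walkOf_cons_pos]
      exact hA.symm ▸ ha
    · rw [edgeLabels_cons_neg ha] at h
      obtain ⟨s, hs, rfl⟩ := ih h
      obtain ⟨A, -, hA⟩ := Finset.exists_subset_card_eq
        (s := (Finset.univ : Finset (Fin n))) (n := a) (by simpa using hc a (by simp))
      refine ⟨A :: s, by simp [hA, hs], ?_⟩
      rw [walkOf_cons_neg]
      exact hA.symm ▸ ha

theorem exists_path_eq_walkOf {c : List ℕ} (hc : ∀ a ∈ c, a ≤ n) {σ : List (EdgeLabel n)}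
    (h : σ = edgeLabels n c) (p : (weightGraph n).Path σ) :
    ∃ s : List (Finset (Fin n)), s.map Finset.card = c ∧ p.rest = walkOf p.src s := by
  subst h
  exact exists_eq_walkOf hc p.isWalk

/-- The path starting at `x` that is traced by a list of subsets. -/
def tracePath {σ : List (EdgeLabel n)} (x : WeightLattice n) (s : List (Finset (Fin n)))
    (h : σ = edgeLabels n (s.map Finset.card)) : (weightGraph n).Path σ :=
  ⟨x, walkOf x s, h ▸ isWalk_walkOf s x⟩

theorem walkOf_append (s t : List (Finset (Fin n))) : ∀ x : WeightLattice n,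
    walkOf x (s ++ t) = walkOf x s ++ walkOf (x + (s.map (subsetWeight n)).sum) t := by
  induction s with
  | nil => intro x; simp [walkOf]
  | cons A s ih =>
    intro x
    by_cases h : 1 ≤ A.card ∧ A.card < n
    · rw [List.cons_append, walkOf_cons_pos h, walkOf_cons_pos h, ih]
      simp [add_assoc]
    · rw [List.cons_append, walkOf_cons_neg h, walkOf_cons_neg h, ih]
      simp [subsetWeight_eq_zero_of_not h]

theorem getLastD_walkOf (s : List (Finset (Fin n))) : ∀ x : WeightLattice n,
    (walkOf x s).getLastD x = x + (s.map (subsetWeight n)).sum := by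
  induction s with
  | nil => intro x; simp [walkOf]
  | cons A s ih =>
    intro x
    by_cases h : 1 ≤ A.card ∧ A.card < n
    · rw [walkOf_cons_pos h, List.getLastD_cons, ih]
      simp [add_assoc]
    · rw [walkOf_cons_neg h, ih]
      simp [subsetWeight_eq_zero_of_not h]

/-! ### Uniqueness of the encoding by subsets -/

theorem eq_of_subsetWeight_eq {A B : Finset (Fin n)} (hc : A.card = B.card)
    (h : subsetWeight n A = subsetWeight n B) : A = B := by
  have := coverCount_eq_of_weight_eq (s := [A]) (t := [B]) (by simpa using h) (by simpa using hc)
  ext i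
  have := congrFun this i
  simp only [coverCount, List.map_cons, List.map_nil, List.sum_cons, List.sum_nil] at this
  by_cases h1 : i ∈ A <;> by_cases h2 : i ∈ B <;> simp_all

theorem eq_of_card_eq_of_not {A B : Finset (Fin n)} (hc : A.card = B.card)
    (h : ¬ (1 ≤ A.card ∧ A.card < n)) : A = B :=
  eq_of_subsetWeight_eq hc
    ((subsetWeight_eq_zero_of_not h).trans (subsetWeight_eq_zero_of_not (hc ▸ h)).symm)

/-- A visible step determines its subset, since size and weight do. Where no step is taken, the size
is `0` or `n` and alone determines the subset. -/
theorem walkOf_inj {s : List (Finset (Fin n))} : ∀ {t : List (Finset (Fin n))}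
    {x : WeightLattice n}, s.map Finset.card = t.map Finset.card → walkOf x s = walkOf x t →
    s = t := by
  induction s with
  | nil =>
    rintro (_ | ⟨B, t⟩) x hc _
    · rfl
    · simp at hc
  | cons A s ih =>
    rintro (_ | ⟨B, t⟩) x hc h
    · simp at hc
    simp only [List.map_cons, List.cons.injEq] at hc
    by_cases hA : 1 ≤ A.card ∧ A.card < n
    · rw [walkOf_cons_pos hA, walkOf_cons_pos (hc.1 ▸ hA), List.cons.injEq] at h
      obtain rfl := eq_of_subsetWeight_eq hc.1 (add_left_cancel h.1)
      rw [ih hc.2 h.2]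
    · rw [walkOf_cons_neg hA, walkOf_cons_neg (hc.1 ▸ hA)] at h
      rw [eq_of_card_eq_of_not hc.1 hA, ih hc.2 h]

/-- The lists of subsets with prescribed cardinalities. -/
def ofCards (n : ℕ) : List ℕ → Finset (List (Finset (Fin n)))
  | [] => {[]}
  | a :: c => (Finset.powersetCard a Finset.univ ×ˢ ofCards n c).map
      ⟨fun z => z.1 :: z.2, fun z z' h => by simpa [Prod.ext_iff] using h⟩

theorem mem_ofCards {c : List ℕ} : ∀ {s : List (Finset (Fin n))},
    s ∈ ofCards n c ↔ s.map Finset.card = c := by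
  induction c with
  | nil => simp [ofCards]
  | cons a c ih =>
    rintro (_ | ⟨A, s⟩)
    · simp [ofCards]
    · simp only [ofCards, Finset.mem_map, Prod.exists, Finset.mem_product,
        Finset.mem_powersetCard_univ, ih, List.cons.injEq, List.map_cons]
      refine ⟨fun ⟨_, _, h, h'⟩ => ?_, fun h => ⟨A, s, h, rfl⟩⟩
      obtain ⟨rfl, rfl⟩ := List.cons.inj h'
      exact h

theorem sum_ofCards_nil {R : Type*} [AddCommMonoid R] (f : List (Finset (Fin n)) → R) :
    ∑ s ∈ ofCards n [], f s = f [] := Finset.sum_singleton _ _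

theorem sum_ofCards_cons {R : Type*} [AddCommMonoid R] (a : ℕ) (c : List ℕ)
    (f : List (Finset (Fin n)) → R) : ∑ s ∈ ofCards n (a :: c), f s =
      ∑ A ∈ Finset.powersetCard a Finset.univ, ∑ s ∈ ofCards n c, f (A :: s) := by
  rw [ofCards, Finset.sum_map, Finset.sum_product]
  rfl

/-- A path is cut after a number of edges, a list of subsets after a number of entries. The two
numbers differ when `c` contains `0` or `n`; the equality `hl` reconciles them. -/
theorem walkOf_split {c c' : List ℕ} {σ σ' : List (EdgeLabel n)}
    {s : List (Finset (Fin n))} (hs : s.map Finset.card = c ++ c')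
    (h : σ = edgeLabels n c) (p : (weightGraph n).Path (σ ++ σ'))
    (hp : p.rest = walkOf p.src s) :
    (p.left σ σ').rest = walkOf p.src (s.take c.length) ∧
      (p.right σ σ').rest = walkOf (p.right σ σ').src (s.drop c.length) := by
  have hl : (walkOf p.src (s.take c.length)).length = σ.length := by
    refine (isWalk_walkOf (s.take c.length) p.src).length_eq.trans (congrArg List.length ?_)
    rw [h, List.map_take, hs, List.take_left]
  have hw := hp
  rw [← List.take_append_drop c.length s, walkOf_append] at hw
  have h1 : (p.left σ σ').rest = walkOf p.src (s.take c.length) := by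
    change p.rest.take σ.length = _
    rw [hw, ← hl, List.take_left]
  refine ⟨h1, ?_⟩
  have h2 : (p.right σ σ').src =
      p.src + ((s.take c.length).map (subsetWeight n)).sum := by
    change (p.left σ σ').rest.getLastD p.src = _
    rw [h1, getLastD_walkOf]
  rw [h2]
  change p.rest.drop σ.length = _
  rw [hw, ← hl, List.drop_left]

end Walks

/-! ## Morphisms given by matrices indexed by lists of subsets -/

/-- The morphism `φ` of the graph planar algebra of the weight lattice takes the value `M s t` on the
pairs of paths with common source traced by lists of subsets `s` and `t` with cardinalities `c`
and `d`. -/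
structure Represents {k : Type u} [Field k] {n : ℕ} (c d : List ℕ) {X Y : GPA k (weightGraph n)}
    (φ : X ⟶ Y) (M : List (Finset (Fin n)) → List (Finset (Fin n)) → k) : Prop where
  source : X.seq = edgeLabels n c
  target : Y.seq = edgeLabels n d
  toFun_eq : ∀ s t, s.map Finset.card = c → t.map Finset.card = d →
    ∀ (p : (weightGraph n).Path X.seq) (q : (weightGraph n).Path Y.seq), p.src = q.src →
      p.rest = walkOf p.src s → q.rest = walkOf q.src t → φ.toFun p q = M s t

namespace Represents

variable {k : Type u} [Field k] {n : ℕ} {c d e c' d' : List ℕ}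
  {X Y Z X' Y' : GPA k (weightGraph n)} {φ ψ : X ⟶ Y}
  {M N : List (Finset (Fin n)) → List (Finset (Fin n)) → k}

theorem congr (h : Represents c d φ M) (hMN : ∀ s t, s.map Finset.card = c →
    t.map Finset.card = d → M s t = N s t) : Represents c d φ N :=
  ⟨h.source, h.target, fun s t hs ht p q h0 hp hq =>
    (h.toFun_eq s t hs ht p q h0 hp hq).trans (hMN s t hs ht)⟩

/-- Morphisms with equal matrices are equal; only entries whose row and column have the same total
weight matter. -/
theorem hom_eq (hφ : Represents c d φ M) (hψ : Represents c d ψ N) (hc : ∀ a ∈ c, a ≤ n)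
    (hd : ∀ a ∈ d, a ≤ n)
    (h : ∀ s t, s.map Finset.card = c → t.map Finset.card = d →
      (s.map (subsetWeight n)).sum = (t.map (subsetWeight n)).sum → M s t = N s t) : φ = ψ := by
  apply GPA.hom_ext
  intro p q
  by_cases hpq : p.Matched q
  · obtain ⟨s, hs, hp⟩ := exists_path_eq_walkOf hc hφ.source p
    obtain ⟨t, ht, hq⟩ := exists_path_eq_walkOf hd hφ.target q
    rw [hφ.toFun_eq s t hs ht p q hpq.1 hp hq, hψ.toFun_eq s t hs ht p q hpq.1 hp hq]
    refine h s t hs ht ?_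
    have h2 : p.rest.getLastD p.src = q.rest.getLastD q.src := hpq.2
    rw [hp, hq, getLastD_walkOf, getLastD_walkOf, hpq.1] at h2
    exact add_left_cancel h2
  · rw [GPA.Hom.vanish φ p q hpq, GPA.Hom.vanish ψ p q hpq]

/-- The sum runs over all lists with sizes `d`, although composition only uses matching paths: at a
list whose path does not match, `M s r` is a value of `φ` on an unmatched pair and hence zero. The
bound on `d` ensures that every intermediate path comes from a list. -/
theorem comp {χ : Y ⟶ Z} (hφ : Represents c d φ M) (hχ : Represents d e χ N)
    (hd : ∀ a ∈ d, a ≤ n) :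
    Represents c e (φ ≫ χ) fun s t => ∑ r ∈ ofCards n d, M s r * N r t := by
  refine ⟨hφ.source, hχ.target, fun s t hs ht p q h0 hp hq => ?_⟩
  rw [GPA.comp_toFun]
  symm
  refine Finset.sum_bij_ne_zero
    (fun r hr _ => tracePath p.src r (by rw [hφ.target, ← mem_ofCards.1 hr])) ?_ ?_ ?_ ?_
  · intro r hr h
    rw [LabeledGraph.Path.mem_matching]
    by_contra h'
    refine h ?_
    have hY : Y.seq = edgeLabels n (r.map Finset.card) := by rw [hφ.target, mem_ofCards.1 hr]
    rw [← hφ.toFun_eq s r hs (mem_ofCards.1 hr) p (tracePath p.src r hY) rfl hp rfl,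
      GPA.Hom.vanish φ _ _ h', zero_mul]
  · intro r hr _ r' hr' _ h
    exact walkOf_inj ((mem_ofCards.1 hr).trans (mem_ofCards.1 hr').symm)
      (congrArg LabeledGraph.Path.rest h)
  · intro r hr h
    obtain ⟨v, hv, hr'⟩ := exists_path_eq_walkOf hd hφ.target r
    have hsrc := (LabeledGraph.Path.mem_matching.1 hr).1
    refine ⟨v, mem_ofCards.2 hv, ?_, ?_⟩
    · rwa [← hφ.toFun_eq s v hs hv p r hsrc hp hr', ← hχ.toFun_eq v t hv ht r q (hsrc ▸ h0) hr' hq]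
    · ext1
      · exact hsrc
      · rw [hr', hsrc]; rfl
  · intro r hr _
    have hY : Y.seq = edgeLabels n (r.map Finset.card) := by rw [hφ.target, mem_ofCards.1 hr]
    rw [← hφ.toFun_eq s r hs (mem_ofCards.1 hr) p (tracePath p.src r hY) rfl hp rfl,
      ← hχ.toFun_eq r t (mem_ofCards.1 hr) ht (tracePath p.src r hY) q h0 rfl hq]

theorem tensor {φ' : X' ⟶ Y'} (hφ : Represents c d φ M) (hφ' : Represents c' d' φ' N) :
    Represents (c ++ c') (d ++ d') (GPA.tensorHom φ φ') fun s t =>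
      M (s.take c.length) (t.take d.length) * N (s.drop c.length) (t.drop d.length) := by
  refine ⟨?_, ?_, fun s t hs ht p q h0 hp hq => ?_⟩
  · rw [edgeLabels_append, ← hφ.source, ← hφ'.source]; rfl
  · rw [edgeLabels_append, ← hφ.target, ← hφ'.target]; rfl
  obtain ⟨hp1, hp2⟩ := walkOf_split hs hφ.source p hp
  obtain ⟨hq1, hq2⟩ := walkOf_split ht hφ.target q hq
  have h1 := hφ.toFun_eq (s.take c.length) (t.take d.length) (by simp [List.map_take, hs])
    (by simp [List.map_take, ht]) (p.left X.seq X'.seq) (q.left Y.seq Y'.seq) h0 hp1 hq1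
  change φ.toFun (p.left X.seq X'.seq) (q.left Y.seq Y'.seq) *
    φ'.toFun (p.right X.seq X'.seq) (q.right Y.seq Y'.seq) = _
  -- The right halves have a common source only when the left halves match, so only then is `N` the
  -- value of the second factor. Otherwise the first factor is zero, and so is its entry in `M`.
  by_cases hm : (p.left X.seq X'.seq).Matched (q.left Y.seq Y'.seq)
  · rw [h1, hφ'.toFun_eq (s.drop c.length) (t.drop d.length) (by simp [List.map_drop, hs])
      (by simp [List.map_drop, ht]) (p.right X.seq X'.seq) (q.right Y.seq Y'.seq) hm.2 hp2 hq2]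
  · rw [GPA.Hom.vanish φ _ _ hm] at h1
    rw [GPA.Hom.vanish φ _ _ hm, ← h1, zero_mul, zero_mul]

theorem id (h : X.seq = edgeLabels n c) :
    Represents c c (𝟙 X) fun s t => if s = t then 1 else 0 := by
  classical
  refine ⟨h, h, fun s t hs ht p q h0 hp hq => ?_⟩
  change (if p = q then (1 : k) else 0) = _
  refine if_congr ⟨?_, ?_⟩ rfl rfl
  · rintro rfl
    exact walkOf_inj (hs.trans ht.symm) (hp.symm.trans hq)
  · rintro rfl
    ext1
    · exact h0
    · rw [hp, hq, h0]

theorem zero (h : X.seq = edgeLabels n c) (h' : Y.seq = edgeLabels n d) :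
    Represents c d (0 : X ⟶ Y) fun _ _ => 0 :=
  ⟨h, h', fun _ _ _ _ _ _ _ _ _ => rfl⟩

theorem add (hφ : Represents c d φ M) (hψ : Represents c d ψ N) :
    Represents c d (φ + ψ) fun s t => M s t + N s t :=
  ⟨hφ.source, hφ.target, fun s t hs ht p q h0 hp hq => by
    rw [GPA.add_toFun, hφ.toFun_eq s t hs ht p q h0 hp hq, hψ.toFun_eq s t hs ht p q h0 hp hq]⟩

theorem smul (r : k) (hφ : Represents c d φ M) : Represents c d (r • φ) fun s t => r * M s t :=
  ⟨hφ.source, hφ.target, fun s t hs ht p q h0 hp hq => by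
    rw [GPA.smul_toFun, hφ.toFun_eq s t hs ht p q h0 hp hq]⟩

theorem eqToHom_comp_comp (hφ : Represents c d φ M) (h : X' = X) (h' : Y = Y') :
    Represents c d (eqToHom h ≫ φ ≫ eqToHom h') M := by
  subst h h'
  simpa using hφ

end Represents

/-! ## Evaluation of formal webs -/

theorem reduceSeq_append {n : ℕ} (a b : List (WebLabel n)) :
    reduceSeq (a ++ b) = reduceSeq a ++ reduceSeq b := List.filterMap_append

/-- The morphism of the graph planar algebra assigned to a formal web: every vertex is sent to a
triangle indicator map. -/
noncomputable def PreWeb.eval {k : Type u} [Field k] {n : ℕ} : ∀ {a b : List (WebLabel n)},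
    PreWeb k n a b → ((⟨reduceSeq a⟩ : GPA k (weightGraph n)) ⟶ ⟨reduceSeq b⟩)
  | _, _, .id _ => 𝟙 _
  | _, _, .comp f g => f.eval ≫ g.eval
  | _, _, .tensor f g => eqToHom (congrArg GPA.mk (reduceSeq_append _ _)) ≫
      GPA.tensorHom f.eval g.eval ≫ eqToHom (congrArg GPA.mk (reduceSeq_append _ _).symm)
  | _, _, .zero => 0
  | _, _, .add f g => f.eval + g.eval
  | _, _, .smul r f => r • f.eval
  | _, _, .merge _ _ _ => GPA.triangle _ _
  | _, _, .split _ _ _ => GPA.triangle _ _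
  | _, _, .dot _ => GPA.triangle _ _
  | _, _, .codot _ => GPA.triangle _ _

theorem PreWeb.eval_cast {k : Type u} [Field k] {n : ℕ} {a b a' b' : List (WebLabel n)}
    (h : a = a') (h' : b = b') (f : PreWeb k n a b) :
    (f.cast h h').eval = eqToHom (by rw [h]) ≫ f.eval ≫ eqToHom (by rw [h']) := by
  subst h h'
  simp [PreWeb.cast]

/-! ### The matrices of the vertices -/

theorem coverCount_pair {n : ℕ} (A B : Finset (Fin n)) (i : Fin n) :
    coverCount [A, B] i = (if i ∈ A then 1 else 0) + if i ∈ B then 1 else 0 := by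
  simp [coverCount]

theorem coverCount_singleton {n : ℕ} (A : Finset (Fin n)) (i : Fin n) :
    coverCount [A] i = if i ∈ A then 1 else 0 := by
  simp [coverCount]

theorem subsetWeight_union {n : ℕ} {A B : Finset (Fin n)} (h : Disjoint A B) :
    subsetWeight n (A ∪ B) = subsetWeight n A + subsetWeight n B := by
  rw [subsetWeight, subsetWeight, subsetWeight, Finset.sum_union h, map_add]

/-- Equal counting functions forbid an element covered twice, because `C` covers each element at
most once. The equivalence includes the case of a full `C`, whose weight is zero. -/
theorem subsetWeight_add_eq_iff {n : ℕ} {A B C : Finset (Fin n)} (h : A.card + B.card = C.card) :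
    subsetWeight n A + subsetWeight n B = subsetWeight n C ↔ Disjoint A B ∧ A ∪ B = C := by
  constructor
  · intro hw
    have hc := coverCount_eq_of_weight_eq (s := [A, B]) (t := [C]) (by simpa using hw)
      (by simpa using h)
    have hc' : ∀ i, _ := fun i => congrFun hc i
    simp only [coverCount_pair, coverCount_singleton] at hc'
    constructor
    · rw [Finset.disjoint_left]
      intro i h1 h2
      have := hc' i
      rw [if_pos h1, if_pos h2] at this
      split_ifs at this <;> omega
    · ext i
      have := hc' i
      rw [Finset.mem_union]
      by_cases h1 : i ∈ A <;> by_cases h2 : i ∈ B <;> by_cases h3 : i ∈ C <;> simp_all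
  · rintro ⟨h1, rfl⟩
    exact (subsetWeight_union h1).symm

/-- The matrix of a merge: the two subsets are disjoint and have the third one as union. -/
def mergeMatrix (k : Type u) [Field k] (n : ℕ) :
    List (Finset (Fin n)) → List (Finset (Fin n)) → k
  | [A, B], [C] => if Disjoint A B ∧ A ∪ B = C then 1 else 0
  | _, _ => 0

/-- The sizes make `A` and `B` nonempty and proper, so their weights are nonzero and a matched pair
never repeats a vertex: being a cycle reduces to the equality of weights. -/
theorem boundsCycle_merge_iff {n : ℕ} {σ τ : List (EdgeLabel n)} {p : (weightGraph n).Path σ}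
    {q : (weightGraph n).Path τ} {A B C : Finset (Fin n)} (hA : 1 ≤ A.card) (hB : 1 ≤ B.card)
    (h : A.card + B.card = C.card) (h0 : p.src = q.src) (hp : p.rest = walkOf p.src [A, B])
    (hq : q.rest = walkOf q.src [C]) :
    (p.BoundsCycle q ↔ Disjoint A B ∧ A ∪ B = C) ∧
      (q.BoundsCycle p ↔ Disjoint A B ∧ A ∪ B = C) := by
  rw [← subsetWeight_add_eq_iff h]
  have hCn : C.card ≤ n := by simpa using C.card_le_univ
  have hA' : 1 ≤ A.card ∧ A.card < n := by omega
  have hB' : 1 ≤ B.card ∧ B.card < n := by omega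
  have hA0 := subsetWeight_ne_zero hA'
  have hB0 := subsetWeight_ne_zero hB'
  rw [walkOf_cons_pos hA', walkOf_cons_pos hB', walkOf] at hp
  obtain ⟨x, vs, hv⟩ := p
  obtain ⟨y, ws, hw⟩ := q
  dsimp only at h0 hp hq
  subst h0 hp hq
  by_cases hC : 1 ≤ C.card ∧ C.card < n
  · have hC0 := subsetWeight_ne_zero hC
    have hw' : walkOf x [C] = [x + subsetWeight n C] := walkOf_cons_pos hC _ _
    simp only [LabeledGraph.Path.BoundsCycle, LabeledGraph.Path.Matched, LabeledGraph.Path.tgt,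
      LabeledGraph.Path.verts, hw']
    have e1 : subsetWeight n A + subsetWeight n B = subsetWeight n C →
      subsetWeight n A ≠ subsetWeight n C := fun h h' => hB0 (by simpa [← h'] using h)
    simp [add_assoc, hA0, hC0]
    exact ⟨e1, fun h => h.1.symm, fun h => ⟨h.symm, h ▸ hC0, hB0⟩⟩
  -- Here `C` is full, so `q` has length `0` and the closed walk visits only two vertices.
  · have hC0 := subsetWeight_eq_zero_of_not hC
    have hw' : walkOf x [C] = [] := walkOf_cons_neg hC _ _
    simp only [LabeledGraph.Path.BoundsCycle, LabeledGraph.Path.Matched, LabeledGraph.Path.tgt,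
      LabeledGraph.Path.verts, hw']
    simp [add_assoc, hA0, hC0]
    exact fun _ => hB0

theorem map_card_eq_singleton {n a : ℕ} {s : List (Finset (Fin n))}
    (h : s.map Finset.card = [a]) : ∃ A, s = [A] ∧ A.card = a := by
  obtain ⟨A, s, rfl, rfl, h'⟩ := List.map_eq_cons_iff.1 h
  obtain rfl := List.map_eq_nil_iff.1 h'
  exact ⟨A, rfl, rfl⟩

theorem map_card_eq_pair {n a b : ℕ} {s : List (Finset (Fin n))}
    (h : s.map Finset.card = [a, b]) : ∃ A B, s = [A, B] ∧ A.card = a ∧ B.card = b := by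
  obtain ⟨A, s, rfl, rfl, h'⟩ := List.map_eq_cons_iff.1 h
  obtain ⟨B, rfl, rfl⟩ := map_card_eq_singleton h'
  exact ⟨A, B, rfl, rfl, rfl⟩

theorem map_card_eq_triple {n a b c : ℕ} {s : List (Finset (Fin n))}
    (h : s.map Finset.card = [a, b, c]) :
    ∃ A B C, s = [A, B, C] ∧ A.card = a ∧ B.card = b ∧ C.card = c := by
  obtain ⟨A, s, rfl, rfl, h'⟩ := List.map_eq_cons_iff.1 h
  obtain ⟨B, C, rfl, rfl, rfl⟩ := map_card_eq_pair h'
  exact ⟨A, B, C, rfl, rfl, rfl, rfl⟩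

/-! ### Matrices of the generators and of formal operations -/

section Vertices

open PreWeb

variable (k : Type u) [Field k] {n : ℕ}

theorem represents_merge (i j : WebLabel n) (h : i.1 + j.1 ≤ n) :
    Represents [i.1, j.1] [i.1 + j.1] (merge (k := k) i j h).eval (mergeMatrix k n) := by
  refine ⟨reduceSeq_eq_edgeLabels _, reduceSeq_eq_edgeLabels _, fun s t hs ht p q h0 hp hq => ?_⟩
  obtain ⟨A, B, rfl, hA, hB⟩ := map_card_eq_pair hs
  obtain ⟨C, rfl, hC⟩ := map_card_eq_singleton ht
  have := boundsCycle_merge_iff (hA ▸ i.2.1) (hB ▸ j.2.1) (by omega) h0 hp hq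
  -- `GPA.triangle` decides its condition classically and `mergeMatrix` does not, so the instance is
  -- given explicitly.
  refine @if_congr _ _ _ (Classical.propDecidable _) _ _ _ _ _ this.1 rfl rfl

theorem represents_split (i j : WebLabel n) (h : i.1 + j.1 ≤ n) :
    Represents [i.1 + j.1] [i.1, j.1] (split (k := k) i j h).eval
      (fun s t => mergeMatrix k n t s) := by
  refine ⟨reduceSeq_eq_edgeLabels _, reduceSeq_eq_edgeLabels _, fun s t hs ht q p h0 hq hp => ?_⟩
  obtain ⟨A, B, rfl, hA, hB⟩ := map_card_eq_pair ht
  obtain ⟨C, rfl, hC⟩ := map_card_eq_singleton hs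
  have := boundsCycle_merge_iff (hA ▸ i.2.1) (hB ▸ j.2.1) (by omega) h0.symm hp hq
  refine @if_congr _ _ _ (Classical.propDecidable _) _ _ _ _ _ this.2 rfl rfl

theorem represents_dot (hn : 1 ≤ n) :
    Represents [n] [] (dot (k := k) hn).eval (fun _ _ => 1) := by
  refine ⟨reduceSeq_eq_edgeLabels _, reduceSeq_eq_edgeLabels _, fun s t hs ht p q h0 hp hq => ?_⟩
  obtain ⟨A, rfl, hA⟩ := map_card_eq_singleton hs
  obtain rfl := List.map_eq_nil_iff.1 ht
  rw [walkOf_cons_neg (by omega)] at hp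
  refine if_pos ⟨⟨h0, ?_⟩, ?_⟩
  · simp [LabeledGraph.Path.tgt, hp, hq, h0, walkOf]
  · simp [LabeledGraph.Path.verts, hp, hq, walkOf]

theorem represents_codot (hn : 1 ≤ n) :
    Represents [] [n] (codot (k := k) hn).eval (fun _ _ => 1) := by
  refine ⟨reduceSeq_eq_edgeLabels _, reduceSeq_eq_edgeLabels _, fun s t hs ht p q h0 hp hq => ?_⟩
  obtain ⟨A, rfl, hA⟩ := map_card_eq_singleton ht
  obtain rfl := List.map_eq_nil_iff.1 hs
  rw [walkOf_cons_neg (by omega)] at hq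
  refine if_pos ⟨⟨h0, ?_⟩, ?_⟩
  · simp [LabeledGraph.Path.tgt, hp, hq, h0, walkOf]
  · simp [LabeledGraph.Path.verts, hp, hq, walkOf]

variable {k}

theorem represents_cast {c d : List ℕ} {a b a' b' : List (WebLabel n)} (h : a = a') (h' : b = b')
    {f : PreWeb k n a b} {M : List (Finset (Fin n)) → List (Finset (Fin n)) → k}
    (hf : Represents c d f.eval M) : Represents c d (f.cast h h').eval M := by
  subst h h'
  exact hf

theorem represents_tensor {c d c' d' : List ℕ} {a b a' b' : List (WebLabel n)}
    {f : PreWeb k n a b} {g : PreWeb k n a' b'}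
    {M N : List (Finset (Fin n)) → List (Finset (Fin n)) → k}
    (hf : Represents c d f.eval M) (hg : Represents c' d' g.eval N) :
    Represents (c ++ c') (d ++ d') (tensor f g).eval fun s t =>
      M (s.take c.length) (t.take d.length) * N (s.drop c.length) (t.drop d.length) :=
  (hf.tensor hg).eqToHom_comp_comp _ _

theorem represents_id_label (i : WebLabel n) :
    Represents [i.1] [i.1] (PreWeb.id (k := k) [i]).eval fun s t => if s = t then 1 else 0 :=
  Represents.id (reduceSeq_eq_edgeLabels _)

theorem represents_id_strand (a : ℕ) :
    Represents [a] [a] (PreWeb.id (k := k) (strand n a)).eval fun s t => if s = t then 1 else 0 :=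
  Represents.id (reduceSeq_strand _)

theorem represents_sum {c d : List ℕ} {a b : List (WebLabel n)} {f : ℕ → PreWeb k n a b}
    {M : ℕ → List (Finset (Fin n)) → List (Finset (Fin n)) → k} (hc : reduceSeq a = edgeLabels n c)
    (hd : reduceSeq b = edgeLabels n d) (hf : ∀ t, Represents c d (f t).eval (M t)) (N : ℕ) :
    Represents c d (PreWeb.sum f N).eval fun s t => ∑ m ∈ Finset.range N, M m s t := by
  induction N with
  | zero => exact Represents.zero hc hd
  | succ N ih => exact (ih.add (hf N)).congr fun s t _ _ => (Finset.sum_range_succ _ _).symm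

end Vertices

/-! ## The combinatorics of the square switch relations -/

section Counting

variable {n : ℕ}

theorem indicator_mul_indicator {R : Type*} [Semiring R] (p q : Prop) [Decidable p] [Decidable q] :
    (if p then (1 : R) else 0) * (if q then 1 else 0) = if p ∧ q then 1 else 0 := by
  by_cases p <;> by_cases q <;> simp_all

/-- This evaluates sums over intermediate lists in which the subsets are forced: `x` is the only
candidate and `K` the condition for it to contribute. -/
theorem sum_eq_indicator {R ι : Type*} [Semiring R] [DecidableEq ι] {S : Finset ι} {f : ι → R}
    (x : ι) (K : Prop) [Decidable K] (hf : ∀ r ∈ S, f r = if r = x ∧ K then 1 else 0)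
    (hx : K → x ∈ S) : ∑ r ∈ S, f r = if K then 1 else 0 := by
  rw [Finset.sum_congr rfl hf]
  by_cases hK : K
  · simp [hK, hx hK]
  · simp [hK]

/-- Removing `X` identifies the interval with the subsets of `Y \ X`. The case `a < X.card` is
separate because truncated subtraction would give a binomial coefficient equal to `1`. -/
theorem card_filter_interval {X Y : Finset (Fin n)} (h : X ⊆ Y) (a : ℕ) :
    ((Finset.powersetCard a Finset.univ).filter fun P => X ⊆ P ∧ P ⊆ Y).card =
      if X.card ≤ a then (Y.card - X.card).choose (a - X.card) else 0 := by
  split_ifs with hX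
  · rw [← Finset.card_sdiff_of_subset h, ← Finset.card_powersetCard]
    refine Finset.card_nbij' (fun P => P \ X) (fun P => P ∪ X) ?_ ?_ ?_ ?_
    · intro P hP
      simp only [Finset.coe_filter, Finset.mem_powersetCard_univ, Set.mem_ofPred_eq] at hP
      simp only [Finset.mem_coe, Finset.mem_powersetCard]
      exact ⟨Finset.sdiff_subset_sdiff hP.2.2 le_rfl,
        by rw [Finset.card_sdiff_of_subset hP.2.1, hP.1]⟩
    · intro P hP
      simp only [Finset.mem_coe, Finset.mem_powersetCard] at hP
      simp only [Finset.coe_filter, Finset.mem_powersetCard_univ, Set.mem_ofPred_eq]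
      have hd : Disjoint P X := Finset.disjoint_of_subset_left hP.1 Finset.sdiff_disjoint
      refine ⟨?_, Finset.subset_union_right,
        Finset.union_subset (hP.1.trans Finset.sdiff_subset) h⟩
      rw [Finset.card_union_of_disjoint hd, hP.2]
      omega
    · intro P hP
      simp only [Finset.coe_filter, Set.mem_ofPred_eq] at hP
      exact Finset.sdiff_union_of_subset hP.2.1
    · intro P hP
      simp only [Finset.mem_coe, Finset.mem_powersetCard] at hP
      have hd : Disjoint P X := Finset.disjoint_of_subset_left hP.1 Finset.sdiff_disjoint
      exact Finset.union_sdiff_cancel_right hd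
  · rw [Finset.card_eq_zero, Finset.filter_eq_empty_iff]
    intro P hP h'
    have := Finset.card_le_card h'.1
    rw [Finset.mem_powersetCard_univ.1 hP] at this
    exact hX this

/-- The number of pairs of subsets with prescribed intersection, union and cardinalities whose first
member lies in an interval. -/
theorem sum_sum_interval (k : Type u) [Field k] {I X Y U : Finset (Fin n)} (hIX : I ⊆ X)
    (hXY : X ⊆ Y) (hYU : Y ⊆ U) {a b : ℕ} (hab : a + b = I.card + U.card) :
    ∑ P ∈ Finset.powersetCard a Finset.univ, ∑ Q ∈ Finset.powersetCard b Finset.univ,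
      (if X ⊆ P ∧ P ⊆ Y ∧ P ∩ Q = I ∧ P ∪ Q = U then (1 : k) else 0) =
    (((if X.card ≤ a then (Y.card - X.card).choose (a - X.card) else 0 : ℕ) : ℤ) : k) := by
  rw [← card_filter_interval hXY, Finset.card_filter]
  push_cast
  refine Finset.sum_congr rfl fun P hP => ?_
  rw [Finset.mem_powersetCard_univ] at hP
  -- Intersection and union force `Q` to consist of `I` and of the part of `U` outside `P`; `hab`
  -- says that this set has size `b`.
  refine sum_eq_indicator (I ∪ (U \ P)) _ (fun Q _ => if_congr ?_ rfl rfl) fun h => ?_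
  · constructor
    · rintro ⟨h1, h2, rfl, rfl⟩
      refine ⟨?_, h1, h2⟩
      grind
    · rintro ⟨rfl, h1, h2⟩
      refine ⟨h1, h2, ?_, ?_⟩ <;> grind
  · rw [Finset.mem_powersetCard_univ, Finset.card_union_of_disjoint,
      Finset.card_sdiff_of_subset (h.2.trans hYU), hP]
    · have := Finset.card_le_card (h.2.trans hYU)
      omega
    · exact Finset.disjoint_of_subset_left (hIX.trans h.1) Finset.disjoint_sdiff

/-- The matrix of a rung that moves `r` elements from the first subset to the second one. -/
def moveMatrix (k : Type u) [Field k] (r : ℕ) (A B A' B' : Finset (Fin n)) : k :=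
  if A' ⊆ A ∧ A ∩ B = A' ∩ B' ∧ A ∪ B = A' ∪ B' ∧ A.card = A'.card + r then 1 else 0

/-- The letters `c`, `e`, `f`, `g` stand for the sizes of `A ∩ B`, `A ∩ A'`, `A ∪ A'`, `A ∪ B`. Over
the integers, `e - c = (m - l + i - j) + (g - f)`, and the index complementary to `m - j - c` in `e
- c` is `m + i - f`. This is therefore the Chu–Vandermonde identity with lower index `m + i - f`;
the conditionals guard truncated subtractions. -/
theorem choose_vandermonde {m l m' l' i j c e f g : ℕ} (h₁ : m + i = m' + j)
    (h₂ : l + j = l' + i) (hce : c ≤ e) (hem : e ≤ m) (hem' : e ≤ m') (hef : e + f = m + m')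
    (hcg : c + g = m + l) (hfg : f ≤ g) :
    (if j ≤ m then ((if c ≤ m - j then (e - c).choose (m - j - c) else 0 : ℕ) : ℤ) else 0) =
      ∑ t ∈ Finset.range (min i j + 1), Ring.choose ((m : ℤ) - l + i - j) t *
        (if i - t ≤ l then ((if f ≤ m + (i - t) then (g - f).choose (m + (i - t) - f) else 0 : ℕ) : ℤ)
          else 0) := by
  have hterm : ∀ t ∈ Finset.range (min i j + 1),
      Ring.choose ((m : ℤ) - l + i - j) t *
        (if i - t ≤ l then ((if f ≤ m + (i - t) then (g - f).choose (m + (i - t) - f) else 0 : ℕ) : ℤ)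
          else 0) =
      if f + t ≤ m + i then Ring.choose ((m : ℤ) - l + i - j) t *
        (((g - f).choose (m + i - f - t) : ℕ) : ℤ) else 0 := by
    intro t ht
    have ht' : t ≤ min i j := Nat.lt_succ_iff.1 (Finset.mem_range.1 ht)
    have ht1 : t ≤ i := ht'.trans (min_le_left _ _)
    have e1 : m + (i - t) - f = m + i - f - t := by omega
    by_cases hf : f + t ≤ m + i
    · rw [if_pos hf, if_pos (by omega : f ≤ m + (i - t)), e1]
      -- When `l < i - t`, the unguarded binomial coefficient is zero as well, since `m + (i - t) >
      -- m + l ≥ g`.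
      by_cases hl : i - t ≤ l
      · rw [if_pos hl]
      · rw [if_neg hl, Nat.choose_eq_zero_of_lt (by omega)]
        simp
    · rw [if_neg hf, if_neg (by omega : ¬ f ≤ m + (i - t))]
      simp
  rw [Finset.sum_congr rfl hterm]
  by_cases hK : f ≤ m + i
  · have hKmin : m + i - f ≤ min i j := by
      rw [le_min_iff]; omega
    have hu : ((e - c : ℕ) : ℤ) = ((m : ℤ) - l + i - j) + ((g - f : ℕ) : ℤ) := by
      push_cast [hce, hfg]; omega
    have hL : (if j ≤ m then ((if c ≤ m - j then (e - c).choose (m - j - c) else 0 : ℕ) : ℤ) else 0)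
        = ((e - c).choose (m + i - f) : ℕ) := by
      by_cases hj : j ≤ m
      · rw [if_pos hj]
        by_cases hc : c ≤ m - j
        · rw [if_pos hc, ← Nat.choose_symm (by omega)]
          congr 2; omega
        · rw [if_neg hc, Nat.choose_eq_zero_of_lt (by omega)]
      · rw [if_neg hj, Nat.choose_eq_zero_of_lt (by omega)]; rfl
    rw [hL, ← Ring.choose_natCast, hu, Ring.add_choose_eq _ (Commute.all _ _),
      Finset.Nat.sum_antidiagonal_eq_sum_range_succ_mk]
    symm
    rw [← Finset.sum_filter]
    refine Finset.sum_congr ?_ fun t _ => ?_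
    · ext t
      simp only [Finset.mem_filter, Finset.mem_range]
      omega
    · rw [Ring.choose_natCast]
  -- Now `m + i < f`, which amounts to `e < m - j` over the integers, so both sides vanish.
  · have hL : (if j ≤ m then ((if c ≤ m - j then (e - c).choose (m - j - c) else 0 : ℕ) : ℤ) else 0)
        = 0 := by
      by_cases hj : j ≤ m
      · rw [if_pos hj]
        by_cases hc : c ≤ m - j
        · rw [if_pos hc, Nat.choose_eq_zero_of_lt (by omega)]; rfl
        · rw [if_neg hc]; rfl
      · rw [if_neg hj]
    rw [hL]
    exact (Finset.sum_eq_zero fun t _ => if_neg (by omega)).symm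

/-- With intersection and union fixed, enlarging one member of a pair shrinks the other, so `B' ⊆ Q`
amounts to `P ⊆ A'`. All conditions can be tested one element at a time. -/
theorem moves_through_lower_iff {A B A' B' P Q : Finset (Fin n)} (hI : A ∩ B = A' ∩ B')
    (hU : A ∪ B = A' ∪ B') :
    ((P ⊆ A ∧ A ∩ B = P ∩ Q ∧ A ∪ B = P ∪ Q) ∧ B' ⊆ Q ∧ Q ∩ P = B' ∩ A' ∧ Q ∪ P = B' ∪ A') ↔
      A ∩ B ⊆ P ∧ P ⊆ A ∩ A' ∧ P ∩ Q = A ∩ B ∧ P ∪ Q = A ∪ B := by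
  simp only [Finset.ext_iff, Finset.subset_iff, Finset.mem_inter, Finset.mem_union,
    ← forall_and] at *
  refine forall_congr' fun x => ?_
  have h1 := hI x
  have h2 := hU x
  clear hI hU
  grind

/-- Dually, `Q ⊆ B` amounts to `A ⊆ P`, so `P` must contain both `A` and `A'`. -/
theorem moves_through_upper_iff {A B A' B' P Q : Finset (Fin n)} (hI : A ∩ B = A' ∩ B')
    (hU : A ∪ B = A' ∪ B') :
    ((Q ⊆ B ∧ B ∩ A = Q ∩ P ∧ B ∪ A = Q ∪ P) ∧ A' ⊆ P ∧ P ∩ Q = A' ∩ B' ∧ P ∪ Q = A' ∪ B') ↔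
      A ∪ A' ⊆ P ∧ P ⊆ A ∪ B ∧ P ∩ Q = A ∩ B ∧ P ∪ Q = A ∪ B := by
  simp only [Finset.ext_iff, Finset.subset_iff, Finset.mem_inter, Finset.mem_union,
    ← forall_and] at *
  refine forall_congr' fun x => ?_
  have h1 := hI x
  have h2 := hU x
  clear hI hU
  grind

/-- Each double sum counts an interval of sets `P`, and the two counts are the two sides of
`choose_vandermonde`, cast to `k`. -/
theorem sum_moveMatrix_square (k : Type u) [Field k] {A B A' B' : Finset (Fin n)}
    {m l m' l' i j : ℕ} (hA : A.card = m) (hB : B.card = l) (hA' : A'.card = m')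
    (hB' : B'.card = l') (hI : A ∩ B = A' ∩ B') (hU : A ∪ B = A' ∪ B') (h₁ : m + i = m' + j)
    (h₂ : l + j = l' + i) :
    ∑ P ∈ Finset.powersetCard (m - j) Finset.univ, ∑ Q ∈ Finset.powersetCard (l + j) Finset.univ,
      moveMatrix k j A B P Q * moveMatrix k i Q P B' A' =
    ∑ t ∈ Finset.range (min i j + 1), PreWeb.binom k ((m : ℤ) - l + i - j) t *
      ∑ P ∈ Finset.powersetCard (m + (i - t)) Finset.univ,
        ∑ Q ∈ Finset.powersetCard (l - (i - t)) Finset.univ,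
          moveMatrix k (i - t) B A Q P * moveMatrix k (j - t) P Q A' B' := by
  have hcg := Finset.card_inter_add_card_union A B
  have hef := Finset.card_inter_add_card_union A A'
  have hIA : A ∩ B ⊆ A ∩ A' := by grind
  have hUA : A ∪ A' ⊆ A ∪ B := by grind
  have hL : ∑ P ∈ Finset.powersetCard (m - j) Finset.univ,
      ∑ Q ∈ Finset.powersetCard (l + j) Finset.univ,
        moveMatrix k j A B P Q * moveMatrix k i Q P B' A' =
      ((if j ≤ m then ((if (A ∩ B).card ≤ m - j then
        ((A ∩ A').card - (A ∩ B).card).choose (m - j - (A ∩ B).card) else 0 : ℕ) : ℤ) else 0 : ℤ) :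
        k) := by
    by_cases hj : j ≤ m
    · rw [if_pos hj, ← sum_sum_interval k (U := A ∪ B) (b := l + j) (Finset.Subset.refl _) hIA
        (Finset.inter_subset_left.trans
        Finset.subset_union_left) (by omega)]
      refine Finset.sum_congr rfl fun P hP => Finset.sum_congr rfl fun Q hQ => ?_
      rw [Finset.mem_powersetCard_univ] at hP hQ
      rw [moveMatrix, moveMatrix, indicator_mul_indicator]
      refine if_congr ?_ rfl rfl
      rw [← moves_through_lower_iff hI hU]
      exact ⟨fun ⟨⟨h1, h2, h3, _⟩, h4, h5, h6, _⟩ => ⟨⟨h1, h2, h3⟩, h4, h5, h6⟩,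
        fun ⟨⟨h1, h2, h3⟩, h4, h5, h6⟩ =>
          ⟨⟨h1, h2, h3, by omega⟩, h4, h5, h6, by omega⟩⟩
    -- For `j > m` the size `m - j` is truncated to `0`. The size clause of `moveMatrix`, here `m =
    -- 0 + j`, then fails and removes the spurious terms.
    · rw [if_neg hj, Int.cast_zero]
      refine Finset.sum_eq_zero fun P hP => Finset.sum_eq_zero fun Q _ => ?_
      rw [Finset.mem_powersetCard_univ] at hP
      rw [moveMatrix, if_neg (by omega), zero_mul]
  have hR : ∀ t ∈ Finset.range (min i j + 1),
      ∑ P ∈ Finset.powersetCard (m + (i - t)) Finset.univ,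
        ∑ Q ∈ Finset.powersetCard (l - (i - t)) Finset.univ,
          moveMatrix k (i - t) B A Q P * moveMatrix k (j - t) P Q A' B' =
      ((if i - t ≤ l then ((if (A ∪ A').card ≤ m + (i - t) then
        ((A ∪ B).card - (A ∪ A').card).choose (m + (i - t) - (A ∪ A').card) else 0 : ℕ) : ℤ)
          else 0 : ℤ) : k) := by
    intro t ht
    have ht' : t ≤ min i j := Nat.lt_succ_iff.1 (Finset.mem_range.1 ht)
    rw [le_min_iff] at ht'
    by_cases hj : i - t ≤ l
    · rw [if_pos hj, ← sum_sum_interval k (I := A ∩ B) (b := l - (i - t))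
        (Finset.inter_subset_left.trans Finset.subset_union_left) hUA
        (Finset.Subset.refl _) (by omega)]
      refine Finset.sum_congr rfl fun P hP => Finset.sum_congr rfl fun Q hQ => ?_
      rw [Finset.mem_powersetCard_univ] at hP hQ
      rw [moveMatrix, moveMatrix, indicator_mul_indicator]
      refine if_congr ?_ rfl rfl
      rw [← moves_through_upper_iff hI hU]
      exact ⟨fun ⟨⟨h1, h2, h3, _⟩, h4, h5, h6, _⟩ => ⟨⟨h1, h2, h3⟩, h4, h5, h6⟩,
        fun ⟨⟨h1, h2, h3⟩, h4, h5, h6⟩ =>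
          ⟨⟨h1, h2, h3, by omega⟩, h4, h5, h6, by omega⟩⟩
    · rw [if_neg hj, Int.cast_zero]
      refine Finset.sum_eq_zero fun P hP => Finset.sum_eq_zero fun Q hQ => ?_
      rw [Finset.mem_powersetCard_univ] at hQ
      rw [moveMatrix, if_neg (by omega), zero_mul]
  rw [hL, choose_vandermonde h₁ h₂ (Finset.card_le_card hIA)
    (hA ▸ Finset.card_le_card Finset.inter_subset_left)
    (hA' ▸ Finset.card_le_card Finset.inter_subset_right) (by omega) (by omega)
    (Finset.card_le_card hUA), Int.cast_sum]
  refine Finset.sum_congr rfl fun t ht => ?_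
  rw [hR t ht, Int.cast_mul, PreWeb.binom]

end Counting

/-! ## Soundness of the relations -/

theorem PreWeb.mergeNat_of_lt {k : Type u} {n a b : ℕ} (h : n < a + b) :
    PreWeb.mergeNat k n a b = .zero :=
  dif_neg (not_le.2 h)

section Relations

open PreWeb

variable {k : Type u} [Field k] {n : ℕ}

theorem mergeMatrix_apply (A B C : Finset (Fin n)) :
    mergeMatrix k n [A, B] [C] = if Disjoint A B ∧ A ∪ B = C then 1 else 0 := rfl

/-- A matrix for cardinalities `c` and `d` determines one for `c'` and `d'` when the lists of subsets
trace the same walks. -/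
theorem Represents.reindex {c d c' d' : List ℕ} {X Y : GPA k (weightGraph n)} {φ : X ⟶ Y}
    {M N : List (Finset (Fin n)) → List (Finset (Fin n)) → k} (hφ : Represents c d φ M)
    (hc : edgeLabels n c = edgeLabels n c') (hd : edgeLabels n d = edgeLabels n d')
    (H : ∀ s t, s.map Finset.card = c' → t.map Finset.card = d' → ∃ s' t',
      s'.map Finset.card = c ∧ t'.map Finset.card = d ∧ (∀ x, walkOf x s = walkOf x s') ∧
        (∀ x, walkOf x t = walkOf x t') ∧ M s' t' = N s t) : Represents c' d' φ N := by
  refine ⟨hφ.source.trans hc, hφ.target.trans hd, fun s t hs ht p q h0 hp hq => ?_⟩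
  obtain ⟨s', t', hs', ht', hws, hwt, hM⟩ := H s t hs ht
  rw [← hM]
  exact hφ.toFun_eq s' t' hs' ht' p q h0 (hp.trans (hws _)) (hq.trans (hwt _))

/-! ### Vertices and rungs with arbitrary natural labels -/

theorem walkOf_empty_cons (x : WeightLattice n) (s : List (Finset (Fin n))) :
    walkOf x (∅ :: s) = walkOf x s := walkOf_cons_neg (by simp) x s

theorem walkOf_append_empty (x : WeightLattice n) (A : Finset (Fin n)) :
    walkOf x [A, ∅] = walkOf x [A] := by
  have h := walkOf_append [A] [∅] x
  rwa [walkOf_empty_cons, walkOf, List.append_nil] at h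

theorem edgeLabels_zero_cons (c : List ℕ) : edgeLabels n (0 :: c) = edgeLabels n c :=
  edgeLabels_cons_neg (by simp) c

theorem edgeLabels_append_zero (a : ℕ) : edgeLabels n [a, 0] = edgeLabels n [a] := by
  have := edgeLabels_append (n := n) [a] [0]
  rwa [edgeLabels_zero_cons, show edgeLabels n [] = [] from rfl, List.append_nil] at this

theorem reduceSeq_strand_pair (a b : ℕ) :
    reduceSeq (strand n a ++ strand n b) = edgeLabels n [a, b] := by
  rw [reduceSeq_append, reduceSeq_strand, reduceSeq_strand, ← edgeLabels_append]
  rfl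

/-- The same matrix serves all cases. A label `0` forces the empty set, for which the merge
condition becomes equality of the other two sets. If `a + b > n`, no set has size `a + b`, and any
matrix represents the zero web. -/
theorem represents_mergeNat (a b : ℕ) :
    Represents [a, b] [a + b] (mergeNat k n a b).eval (mergeMatrix k n) := by
  by_cases h : a + b ≤ n
  · by_cases ha : a = 0
    · rw [mergeNat, dif_pos h, dif_pos ha]
      refine represents_cast _ _ ((represents_id_strand (a + b)).reindex ?_ rfl ?_)
      · subst ha
        rw [edgeLabels_zero_cons, zero_add]
      · intro s t hs ht
        obtain ⟨A, B, rfl, hA, hB⟩ := map_card_eq_pair hs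
        obtain ⟨C, rfl, hC⟩ := map_card_eq_singleton ht
        obtain rfl : A = ∅ := Finset.card_eq_zero.1 (hA.trans ha)
        refine ⟨[B], [C], by simp [ha, hB], ht, fun x => walkOf_empty_cons x _, fun _ => rfl, ?_⟩
        simp [mergeMatrix]
    · by_cases hb : b = 0
      · rw [mergeNat, dif_pos h, dif_neg ha, dif_pos hb]
        refine represents_cast _ _ ((represents_id_strand (a + b)).reindex ?_ rfl ?_)
        · subst hb
          rw [edgeLabels_append_zero, add_zero]
        · intro s t hs ht
          obtain ⟨A, B, rfl, hA, hB⟩ := map_card_eq_pair hs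
          obtain ⟨C, rfl, hC⟩ := map_card_eq_singleton ht
          obtain rfl : B = ∅ := Finset.card_eq_zero.1 (hB.trans hb)
          refine ⟨[A], [C], by simp [hb, hA], ht, fun x => walkOf_append_empty x _, fun _ => rfl, ?_⟩
          simp [mergeMatrix]
      · rw [mergeNat, dif_pos h, dif_neg ha, dif_neg hb]
        exact represents_cast _ _ (represents_merge k ⟨a, _⟩ ⟨b, _⟩ h)
  · rw [mergeNat, dif_neg h]
    refine (Represents.zero (reduceSeq_strand_pair a b) (reduceSeq_strand _)).congr ?_
    intro s t hs ht
    obtain ⟨C, rfl, hC⟩ := map_card_eq_singleton ht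
    have := C.card_le_univ
    rw [Fintype.card_fin] at this
    omega

theorem represents_splitNat (a b : ℕ) :
    Represents [a + b] [a, b] (splitNat k n a b).eval (fun s t => mergeMatrix k n t s) := by
  by_cases h : a + b ≤ n
  · by_cases ha : a = 0
    · rw [splitNat, dif_pos h, dif_pos ha]
      refine represents_cast _ _ ((represents_id_strand (a + b)).reindex rfl ?_ ?_)
      · subst ha
        rw [edgeLabels_zero_cons, zero_add]
      · intro t s ht hs
        obtain ⟨A, B, rfl, hA, hB⟩ := map_card_eq_pair hs
        obtain ⟨C, rfl, hC⟩ := map_card_eq_singleton ht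
        obtain rfl : A = ∅ := Finset.card_eq_zero.1 (hA.trans ha)
        refine ⟨[C], [B], ht, by simp [ha, hB], fun _ => rfl, fun x => walkOf_empty_cons x _, ?_⟩
        simp [mergeMatrix, eq_comm]
    · by_cases hb : b = 0
      · rw [splitNat, dif_pos h, dif_neg ha, dif_pos hb]
        refine represents_cast _ _ ((represents_id_strand (a + b)).reindex rfl ?_ ?_)
        · subst hb
          rw [edgeLabels_append_zero, add_zero]
        · intro t s ht hs
          obtain ⟨A, B, rfl, hA, hB⟩ := map_card_eq_pair hs
          obtain ⟨C, rfl, hC⟩ := map_card_eq_singleton ht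
          obtain rfl : B = ∅ := Finset.card_eq_zero.1 (hB.trans hb)
          refine ⟨[C], [A], ht, by simp [hb, hA], fun _ => rfl, fun x => walkOf_append_empty x _, ?_⟩
          simp [mergeMatrix, eq_comm]
      · rw [splitNat, dif_pos h, dif_neg ha, dif_neg hb]
        exact represents_cast _ _ (represents_split k ⟨a, _⟩ ⟨b, _⟩ h)
  · rw [splitNat, dif_neg h]
    refine (Represents.zero (reduceSeq_strand _) (reduceSeq_strand_pair a b)).congr ?_
    intro s t hs ht
    obtain ⟨C, rfl, hC⟩ := map_card_eq_singleton hs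
    have := C.card_le_univ
    rw [Fintype.card_fin] at this
    omega

/-- The matrix of a rung ascending from left to right. -/
def rungRightMatrix (k : Type u) [Field k] (n r : ℕ) :
    List (Finset (Fin n)) → List (Finset (Fin n)) → k
  | [A, B], [A', B'] => moveMatrix k r A B A' B'
  | _, _ => 0

/-- The matrix of a rung ascending from right to left. -/
def rungLeftMatrix (k : Type u) [Field k] (n r : ℕ) :
    List (Finset (Fin n)) → List (Finset (Fin n)) → k
  | [A, B], [A', B'] => moveMatrix k r B A B' A'
  | _, _ => 0

theorem represents_zero_of_not {m l m' l' : ℕ}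
    {M : List (Finset (Fin n)) → List (Finset (Fin n)) → k}
    (h : ∀ A B A' B' : Finset (Fin n), A.card = m → B.card = l → A'.card = m' → B'.card = l' →
      M [A, B] [A', B'] = 0) :
    Represents [m, l] [m', l']
      (PreWeb.zero : PreWeb k n (strand n m ++ strand n l) (strand n m' ++ strand n l')).eval M := by
  refine (Represents.zero (reduceSeq_strand_pair _ _) (reduceSeq_strand_pair _ _)).congr ?_
  intro s t hs ht
  obtain ⟨A, B, rfl, hA, hB⟩ := map_card_eq_pair hs
  obtain ⟨A', B', rfl, hA', hB'⟩ := map_card_eq_pair ht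
  exact (h A B A' B' hA hB hA' hB').symm

/-- The elements carried by the rung must be `A \ A'`, so there is one candidate for the
intermediate triple. Their being new to `B` is what preserving intersection and union expresses. -/
theorem split_left_merge_right_iff {A B A' B' P Q R : Finset (Fin n)} :
    (((Disjoint P Q ∧ P ∪ Q = A) ∧ B = R) ∧ P = A' ∧ Disjoint Q R ∧ Q ∪ R = B') ↔
      (P = A' ∧ Q = A \ A' ∧ R = B) ∧ A' ⊆ A ∧ A ∩ B = A' ∩ B' ∧ A ∪ B = A' ∪ B' := by
  simp only [Finset.disjoint_left, Finset.ext_iff, Finset.subset_iff, Finset.mem_inter,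
    Finset.mem_union, Finset.mem_sdiff, ← forall_and]
  exact forall_congr' fun x => by grind

theorem split_right_merge_left_iff {A B A' B' P Q R : Finset (Fin n)} :
    ((A = P ∧ Disjoint Q R ∧ Q ∪ R = B) ∧ (Disjoint P Q ∧ P ∪ Q = A') ∧ R = B') ↔
      (P = A ∧ Q = B \ B' ∧ R = B') ∧ B' ⊆ B ∧ B ∩ A = B' ∩ A' ∧ B ∪ A = B' ∪ A' := by
  simp only [Finset.disjoint_left, Finset.ext_iff, Finset.subset_iff, Finset.mem_inter,
    Finset.mem_union, Finset.mem_sdiff, ← forall_and]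
  exact forall_congr' fun x => by grind

theorem represents_rungRight {m l m' l' : ℕ} (r : ℕ) (hm : m ≤ n) (hl : l ≤ n) :
    Represents [m, l] [m', l'] (rungRight k n m l m' l' r).eval (rungRightMatrix k n r) := by
  by_cases h : m = m' + r ∧ l' = r + l
  · rw [rungRight, dif_pos h]
    obtain ⟨rfl, rfl⟩ := h
    have h1 : Represents [m' + r, l] [m', r, l] _ _ :=
      represents_tensor (k := k) (n := n) (represents_splitNat m' r) (represents_id_strand l)
    have h2 : Represents [m', r, l] [m', r + l] _ _ :=
      represents_tensor (k := k) (n := n) (represents_id_strand m') (represents_mergeNat r l)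
    refine represents_cast _ _ (((represents_cast rfl _ h1).comp h2 (by simp; omega)).congr ?_)
    intro s t hs ht
    obtain ⟨A, B, rfl, hA, hB⟩ := map_card_eq_pair hs
    obtain ⟨A', B', rfl, hA', hB'⟩ := map_card_eq_pair ht
    refine sum_eq_indicator [A', A \ A', B] _ ?_ ?_
    · intro v hv
      obtain ⟨P, Q, R, rfl, hP, hQ, hR⟩ := map_card_eq_triple (mem_ofCards.1 hv)
      simp only [List.length_cons, List.length_nil, zero_add, Nat.reduceAdd, List.take_succ_cons,
        List.take_zero, List.drop_succ_cons, List.drop_zero, mergeMatrix_apply,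
        indicator_mul_indicator, List.cons.injEq, and_true]
      refine if_congr ?_ rfl rfl
      rw [split_left_merge_right_iff]
      exact and_congr_right fun _ =>
        ⟨fun ⟨h1, h2, h3⟩ => ⟨h1, h2, h3, by omega⟩, fun ⟨h1, h2, h3, _⟩ => ⟨h1, h2, h3⟩⟩
    · intro h
      have hc := Finset.card_sdiff_of_subset h.1
      rw [mem_ofCards]
      simp only [List.map_cons, List.map_nil, List.cons.injEq, and_true]
      omega
  · rw [rungRight, dif_neg h]
    refine represents_zero_of_not fun A B A' B' hA hB hA' hB' => if_neg fun hK => ?_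
    -- Equal intersections and unions force `m + l = m' + l'`; together with the size clause `m = m'
    -- + r` this yields `l' = r + l`, contrary to `h`.
    have h1 := Finset.card_inter_add_card_union A B
    have h2 := Finset.card_inter_add_card_union A' B'
    have h3 := congrArg Finset.card hK.2.1
    have h4 := congrArg Finset.card hK.2.2.1
    omega

theorem represents_rungLeft {m l m' l' : ℕ} (r : ℕ) (hm : m ≤ n) (hl : l ≤ n) :
    Represents [m, l] [m', l'] (rungLeft k n m l m' l' r).eval (rungLeftMatrix k n r) := by
  by_cases h : l = r + l' ∧ m' = m + r
  · rw [rungLeft, dif_pos h]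
    obtain ⟨rfl, rfl⟩ := h
    have h1 : Represents [m, r + l'] [m, r, l'] _ _ :=
      represents_tensor (k := k) (n := n) (represents_id_strand m) (represents_splitNat r l')
    have h2 : Represents [m, r, l'] [m + r, l'] _ _ :=
      represents_tensor (k := k) (n := n) (represents_mergeNat m r) (represents_id_strand l')
    refine represents_cast _ _ ((h1.comp (represents_cast _ rfl h2) (by simp; omega)).congr ?_)
    intro s t hs ht
    obtain ⟨A, B, rfl, hA, hB⟩ := map_card_eq_pair hs
    obtain ⟨A', B', rfl, hA', hB'⟩ := map_card_eq_pair ht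
    refine sum_eq_indicator [A, B \ B', B'] _ ?_ ?_
    · intro v hv
      obtain ⟨P, Q, R, rfl, hP, hQ, hR⟩ := map_card_eq_triple (mem_ofCards.1 hv)
      simp only [List.length_cons, List.length_nil, zero_add, Nat.reduceAdd, List.take_succ_cons,
        List.take_zero, List.drop_succ_cons, List.drop_zero, mergeMatrix_apply,
        indicator_mul_indicator, List.cons.injEq, and_true]
      refine if_congr ?_ rfl rfl
      rw [split_right_merge_left_iff]
      exact and_congr_right fun _ =>
        ⟨fun ⟨h1, h2, h3⟩ => ⟨h1, h2, h3, by omega⟩, fun ⟨h1, h2, h3, _⟩ => ⟨h1, h2, h3⟩⟩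
    · intro h
      have hc := Finset.card_sdiff_of_subset h.1
      rw [mem_ofCards]
      simp only [List.map_cons, List.map_nil, List.cons.injEq, and_true]
      omega
  · rw [rungLeft, dif_neg h]
    refine represents_zero_of_not fun A B A' B' hA hB hA' hB' => if_neg fun hK => ?_
    have h1 := Finset.card_inter_add_card_union A B
    have h2 := Finset.card_inter_add_card_union A' B'
    have h3 := congrArg Finset.card hK.2.1
    have h4 := congrArg Finset.card hK.2.2.1
    simp only [Finset.inter_comm B, Finset.union_comm B, Finset.inter_comm B',
      Finset.union_comm B'] at h3 h4
    omega

/-! ### The square switch relations -/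

theorem sum_ofCards_pair {R : Type*} [AddCommMonoid R] (a b : ℕ)
    (f : List (Finset (Fin n)) → R) : ∑ s ∈ ofCards n [a, b], f s =
      ∑ A ∈ Finset.powersetCard a Finset.univ, ∑ B ∈ Finset.powersetCard b Finset.univ,
        f [A, B] := by
  simp only [sum_ofCards_cons, sum_ofCards_nil]

theorem powersetCard_univ_eq_empty {a : ℕ} (h : n < a) :
    Finset.powersetCard a (Finset.univ : Finset (Fin n)) = ∅ := by
  rw [Finset.powersetCard_eq_empty, Finset.card_univ, Fintype.card_fin]
  exact h

theorem eval_tensor_zero {a b c d : List (WebLabel n)} (f : PreWeb k n a b) :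
    (tensor f (.zero : PreWeb k n c d)).eval = 0 := by
  have h : GPA.tensorHom f.eval (0 : (⟨reduceSeq c⟩ : GPA k (weightGraph n)) ⟶ ⟨reduceSeq d⟩) = 0 :=
    GPA.hom_ext fun _ _ => mul_zero _
  exact (congrArg (fun φ => eqToHom _ ≫ φ ≫ eqToHom _) h).trans
    ((congrArg _ Limits.zero_comp).trans Limits.comp_zero)

theorem eval_zero_tensor {a b c d : List (WebLabel n)} (g : PreWeb k n c d) :
    (tensor (.zero : PreWeb k n a b) g).eval = 0 := by
  have h : GPA.tensorHom (0 : (⟨reduceSeq a⟩ : GPA k (weightGraph n)) ⟶ ⟨reduceSeq b⟩) g.eval = 0 :=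
    GPA.hom_ext fun _ _ => zero_mul _
  exact (congrArg (fun φ => eqToHom _ ≫ φ ≫ eqToHom _) h).trans
    ((congrArg _ Limits.zero_comp).trans Limits.comp_zero)

theorem eval_zero {a b : List (WebLabel n)} : (PreWeb.zero : PreWeb k n a b).eval = 0 := rfl

theorem eval_comp {a b c : List (WebLabel n)} (f : PreWeb k n a b) (g : PreWeb k n b c) :
    (PreWeb.comp f g).eval = f.eval ≫ g.eval := rfl

/-- `strand` yields the empty sequence for a label above `n`, so vanishing cannot be read off from
the objects; it comes from the zero value of the merge at the end of the rung. -/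
theorem eval_rungRight_eq_zero {m l m' l' : ℕ} (r : ℕ) (h : n < l') :
    (rungRight k n m l m' l' r).eval = 0 := by
  by_cases h' : m = m' + r ∧ l' = r + l
  · obtain ⟨rfl, rfl⟩ := h'
    simp [rungRight, eval_cast, eval_comp, PreWeb.mergeNat_of_lt h, eval_tensor_zero]
  · rw [rungRight, dif_neg h', eval_zero]

theorem eval_rungLeft_eq_zero {m l m' l' : ℕ} (r : ℕ) (h : n < m') :
    (rungLeft k n m l m' l' r).eval = 0 := by
  by_cases h' : l = r + l' ∧ m' = m + r
  · obtain ⟨rfl, rfl⟩ := h'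
    simp [rungLeft, eval_cast, eval_comp, PreWeb.mergeNat_of_lt h, eval_zero_tensor]
  · rw [rungLeft, dif_neg h', eval_zero]

/-- The intermediate label `l₁` may exceed `n`, where matrix multiplication is not available. The
web is then zero, and so is the formula, because no subset has size `l₁`. -/
theorem represents_rungRight_rungLeft {m l m₁ l₁ m' l' : ℕ} (r r' : ℕ) (hm : m ≤ n) (hl : l ≤ n)
    (hm₁ : m₁ ≤ n) :
    Represents [m, l] [m', l']
      (comp (rungRight k n m l m₁ l₁ r) (rungLeft k n m₁ l₁ m' l' r')).eval fun s t =>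
        ∑ P ∈ Finset.powersetCard m₁ Finset.univ, ∑ Q ∈ Finset.powersetCard l₁ Finset.univ,
          rungRightMatrix k n r s [P, Q] * rungLeftMatrix k n r' [P, Q] t := by
  by_cases hl₁ : l₁ ≤ n
  · exact ((represents_rungRight r hm hl).comp (represents_rungLeft r' hm₁ hl₁)
      (by simp; omega)).congr fun s t _ _ => sum_ofCards_pair _ _ _
  · rw [eval_comp, eval_rungRight_eq_zero r (not_le.1 hl₁), Limits.zero_comp,
      powersetCard_univ_eq_empty (not_le.1 hl₁)]
    simp only [Finset.sum_empty, Finset.sum_const_zero]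
    exact Represents.zero (reduceSeq_strand_pair _ _) (reduceSeq_strand_pair _ _)

theorem represents_rungLeft_rungRight {m l m₁ l₁ m' l' : ℕ} (r r' : ℕ) (hm : m ≤ n) (hl : l ≤ n)
    (hl₁ : l₁ ≤ n) :
    Represents [m, l] [m', l']
      (comp (rungLeft k n m l m₁ l₁ r) (rungRight k n m₁ l₁ m' l' r')).eval fun s t =>
        ∑ P ∈ Finset.powersetCard m₁ Finset.univ, ∑ Q ∈ Finset.powersetCard l₁ Finset.univ,
          rungLeftMatrix k n r s [P, Q] * rungRightMatrix k n r' [P, Q] t := by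
  by_cases hm₁ : m₁ ≤ n
  · exact ((represents_rungLeft r hm hl).comp (represents_rungRight r' hm₁ hl₁)
      (by simp; omega)).congr fun s t _ _ => sum_ofCards_pair _ _ _
  · rw [eval_comp, eval_rungLeft_eq_zero r (not_le.1 hm₁), Limits.zero_comp,
      powersetCard_univ_eq_empty (not_le.1 hm₁)]
    simp only [Finset.sum_empty]
    exact Represents.zero (reduceSeq_strand_pair _ _) (reduceSeq_strand_pair _ _)

/-- The intersection is where the counting function equals `2`, the union where it is nonzero. -/
theorem inter_union_eq_of_weight_eq {A B A' B' : Finset (Fin n)}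
    (h : ([A, B].map (subsetWeight n)).sum = ([A', B'].map (subsetWeight n)).sum)
    (hc : A.card + B.card = A'.card + B'.card) : A ∩ B = A' ∩ B' ∧ A ∪ B = A' ∪ B' := by
  have hw := coverCount_eq_of_weight_eq h (by simpa using hc)
  have hw' : ∀ i, _ := fun i => congrFun hw i
  simp only [coverCount_pair] at hw'
  simp only [Finset.ext_iff, Finset.mem_inter, Finset.mem_union, ← forall_and]
  intro x
  have := hw' x
  by_cases h1 : x ∈ A <;> by_cases h2 : x ∈ B <;> by_cases h3 : x ∈ A' <;> by_cases h4 : x ∈ B' <;>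
    simp [h1, h2, h3, h4] at this ⊢

theorem eval_square_switch_right {m l m' l' i j : ℕ} (hm : m ≤ n) (hl : l ≤ n) (hm' : m' ≤ n)
    (hl' : l' ≤ n) (h₁ : m + i = m' + j) (h₂ : l + j = l' + i) :
    (comp (rungRight k n m l (m - j) (l + j) j) (rungLeft k n (m - j) (l + j) m' l' i)).eval =
    (PreWeb.sum (fun t => smul (binom k ((m : ℤ) - l + i - j) t)
      (comp (rungLeft k n m l (m + (i - t)) (l - (i - t)) (i - t))
        (rungRight k n (m + (i - t)) (l - (i - t)) m' l' (j - t)))) (min i j + 1)).eval := by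
  refine (represents_rungRight_rungLeft j i hm hl (by omega)).hom_eq
    (represents_sum (reduceSeq_strand_pair _ _) (reduceSeq_strand_pair _ _)
      (fun t => (represents_rungLeft_rungRight (i - t) (j - t) hm hl (by omega)).smul _) _)
    (by simp; omega) (by simp; omega) fun s t hs ht hw => ?_
  obtain ⟨A, B, rfl, hA, hB⟩ := map_card_eq_pair hs
  obtain ⟨A', B', rfl, hA', hB'⟩ := map_card_eq_pair ht
  obtain ⟨hI, hU⟩ := inter_union_eq_of_weight_eq hw (by omega)
  exact sum_moveMatrix_square k hA hB hA' hB' hI hU h₁ h₂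

theorem eval_square_switch_left {m l m' l' i j : ℕ} (hm : m ≤ n) (hl : l ≤ n) (hm' : m' ≤ n)
    (hl' : l' ≤ n) (h₁ : m + j = m' + i) (h₂ : l + i = l' + j) :
    (comp (rungLeft k n m l (m + j) (l - j) j) (rungRight k n (m + j) (l - j) m' l' i)).eval =
    (PreWeb.sum (fun t => smul (binom k ((l : ℤ) - m + i - j) t)
      (comp (rungRight k n m l (m - (i - t)) (l + (i - t)) (i - t))
        (rungLeft k n (m - (i - t)) (l + (i - t)) m' l' (j - t)))) (min i j + 1)).eval := by
  refine (represents_rungLeft_rungRight j i hm hl (by omega)).hom_eq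
    (represents_sum (reduceSeq_strand_pair _ _) (reduceSeq_strand_pair _ _)
      (fun t => (represents_rungRight_rungLeft (i - t) (j - t) hm hl (by omega)).smul _) _)
    (by simp; omega) (by simp; omega) fun s t hs ht hw => ?_
  obtain ⟨A, B, rfl, hA, hB⟩ := map_card_eq_pair hs
  obtain ⟨A', B', rfl, hA', hB'⟩ := map_card_eq_pair ht
  obtain ⟨hI, hU⟩ := inter_union_eq_of_weight_eq hw (by omega)
  -- The second relation is the mirror image of the first: the uprights are exchanged, and with them
  -- the order of the two summations.
  have := sum_moveMatrix_square k hB hA hB' hA' (by rw [Finset.inter_comm, hI, Finset.inter_comm])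
    (by rw [Finset.union_comm, hU, Finset.union_comm]) h₂ h₁
  rw [Finset.sum_comm]
  refine this.trans (Finset.sum_congr rfl fun t _ => congrArg _ ?_)
  rw [Finset.sum_comm]
  rfl

end Relations

/-! ### Associativity, bigons, univalent vertices and snakes -/

section Soundness

open PreWeb

variable {k : Type u} [Field k] {n : ℕ}

theorem Represents.of_eq {c d c' d' : List ℕ} {X Y : GPA k (weightGraph n)} {φ : X ⟶ Y}
    {M : List (Finset (Fin n)) → List (Finset (Fin n)) → k} (hφ : Represents c d φ M)
    (hc : c = c') (hd : d = d') : Represents c' d' φ M := by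
  subst hc hd
  exact hφ

theorem nested_left_iff {A B C D P Q : Finset (Fin n)} :
    (((Disjoint A B ∧ A ∪ B = P) ∧ C = Q) ∧ Disjoint P Q ∧ P ∪ Q = D) ↔
      (P = A ∪ B ∧ Q = C) ∧ Disjoint A B ∧ Disjoint (A ∪ B) C ∧ A ∪ B ∪ C = D := by
  constructor
  · rintro ⟨⟨⟨h1, rfl⟩, rfl⟩, h2, rfl⟩
    exact ⟨⟨rfl, rfl⟩, h1, h2, rfl⟩
  · rintro ⟨⟨rfl, rfl⟩, h1, h2, rfl⟩
    exact ⟨⟨⟨h1, rfl⟩, rfl⟩, h2, rfl⟩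

theorem nested_right_iff {A B C D P Q : Finset (Fin n)} :
    ((A = P ∧ Disjoint B C ∧ B ∪ C = Q) ∧ Disjoint P Q ∧ P ∪ Q = D) ↔
      (P = A ∧ Q = B ∪ C) ∧ Disjoint A B ∧ Disjoint (A ∪ B) C ∧ A ∪ B ∪ C = D := by
  constructor
  · rintro ⟨⟨rfl, h1, rfl⟩, h2, rfl⟩
    rw [Finset.disjoint_union_right] at h2
    exact ⟨⟨rfl, rfl⟩, h2.1, Finset.disjoint_union_left.2 ⟨h2.2, h1⟩, Finset.union_assoc _ _ _⟩
  · rintro ⟨⟨rfl, rfl⟩, h1, h2, rfl⟩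
    rw [Finset.disjoint_union_left] at h2
    exact ⟨⟨rfl, h2.2, rfl⟩, Finset.disjoint_union_right.2 ⟨h1, h2.1⟩,
      (Finset.union_assoc _ _ _).symm⟩

/-- Each sum has at most one nonzero term, at `[A ∪ B, C]` or at `[A, B ∪ C]`, and both indicate
that `A`, `B`, `C` are pairwise disjoint with union `D`. Keeping `f` and `g` abstract lets the lemma
serve merges and splits alike. -/
theorem sum_nested_eq {A B C D : Finset (Fin n)} {a b c : ℕ} (hA : A.card = a) (hB : B.card = b)
    (hC : C.card = c) {f g : List (Finset (Fin n)) → k}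
    (hf : ∀ P Q, f [P, Q] =
      if ((Disjoint A B ∧ A ∪ B = P) ∧ C = Q) ∧ Disjoint P Q ∧ P ∪ Q = D then 1 else 0)
    (hg : ∀ P Q, g [P, Q] =
      if (A = P ∧ Disjoint B C ∧ B ∪ C = Q) ∧ Disjoint P Q ∧ P ∪ Q = D then 1 else 0) :
    ∑ v ∈ ofCards n [a + b, c], f v = ∑ v ∈ ofCards n [a, b + c], g v := by
  refine (sum_eq_indicator [A ∪ B, C] (Disjoint A B ∧ Disjoint (A ∪ B) C ∧ A ∪ B ∪ C = D)
    (fun v hv => ?_) fun hK => ?_).trans (sum_eq_indicator [A, B ∪ C] _ (fun v hv => ?_)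
      fun hK => ?_).symm
  · obtain ⟨P, Q, rfl, hP, hQ⟩ := map_card_eq_pair (mem_ofCards.1 hv)
    simp only [hf, nested_left_iff, List.cons.injEq, and_true]
  · simp [mem_ofCards, Finset.card_union_of_disjoint hK.1, hA, hB, hC]
  · obtain ⟨P, Q, rfl, hP, hQ⟩ := map_card_eq_pair (mem_ofCards.1 hv)
    simp only [hg, nested_right_iff, List.cons.injEq, and_true]
  · simp [mem_ofCards, Finset.card_union_of_disjoint (Finset.disjoint_union_left.1 hK.2.1).2,
      hA, hB, hC]

theorem eval_merge_assoc (i j l : WebLabel n) (h : i.1 + j.1 + l.1 ≤ n) :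
    (comp (tensor (merge i j (by omega)) (id [l]) : PreWeb k n [i, j, l] [i.add j (by omega), l])
      (merge (i.add j (by omega)) l h)).eval =
    (comp (tensor (id [i]) (merge j l (by omega)) : PreWeb k n [i, j, l] [i, j.add l (by omega)])
      (cast rfl (by rw [WebLabel.add_add i j l h])
        (merge i (j.add l (by omega)) ((Nat.add_assoc _ _ _).symm.trans_le h)))).eval := by
  have h1 : Represents [i.1, j.1, l.1] [i.1 + j.1, l.1] _ _ :=
    represents_tensor (represents_merge k i j (by omega)) (represents_id_label l)
  have h2 : Represents [i.1 + j.1, l.1] [i.1 + j.1 + l.1] _ _ :=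
    represents_merge k (i.add j (by omega)) l h
  have h3 : Represents [i.1, j.1, l.1] [i.1, j.1 + l.1] _ _ :=
    represents_tensor (represents_id_label i) (represents_merge k j l (by omega))
  have h4 : Represents [i.1, j.1 + l.1] [i.1 + (j.1 + l.1)] _ _ :=
    represents_merge k i (j.add l (by omega)) ((Nat.add_assoc _ _ _).symm.trans_le h)
  refine (h1.comp h2 (by simp; omega)).hom_eq (h3.comp (represents_cast rfl _
    (h4.of_eq rfl (by rw [Nat.add_assoc]))) (by simp; omega))
    (by simp; omega) (by simpa using h) fun s t hs ht _ => ?_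
  obtain ⟨A, B, C, rfl, hA, hB, hC⟩ := map_card_eq_triple hs
  obtain ⟨D, rfl, hD⟩ := map_card_eq_singleton ht
  refine sum_nested_eq hA hB hC (D := D) (fun P Q => ?_) fun P Q => ?_ <;>
    simp only [List.length_cons, List.length_nil, zero_add, Nat.reduceAdd, List.take_succ_cons,
      List.take_zero, List.drop_succ_cons, List.drop_zero, mergeMatrix_apply,
      indicator_mul_indicator, List.cons.injEq, and_true]

theorem eval_split_assoc (i j l : WebLabel n) (h : i.1 + j.1 + l.1 ≤ n) :
    (comp (split (i.add j (by omega)) l h)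
      (tensor (split i j (by omega)) (id [l]) :
        PreWeb k n [i.add j (by omega), l] [i, j, l])).eval =
    (comp (cast (by rw [WebLabel.add_add i j l h]) rfl
        (split i (j.add l (by omega)) ((Nat.add_assoc _ _ _).symm.trans_le h)))
      (tensor (id [i]) (split j l (by omega)) :
        PreWeb k n [i, j.add l (by omega)] [i, j, l])).eval := by
  have h1 : Represents [i.1 + j.1, l.1] [i.1, j.1, l.1] _ _ :=
    represents_tensor (represents_split k i j (by omega)) (represents_id_label l)
  have h2 : Represents [i.1 + j.1 + l.1] [i.1 + j.1, l.1] _ _ :=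
    represents_split k (i.add j (by omega)) l h
  have h3 : Represents [i.1, j.1 + l.1] [i.1, j.1, l.1] _ _ :=
    represents_tensor (represents_id_label i) (represents_split k j l (by omega))
  have h4 : Represents [i.1 + (j.1 + l.1)] [i.1, j.1 + l.1] _ _ :=
    represents_split k i (j.add l (by omega)) ((Nat.add_assoc _ _ _).symm.trans_le h)
  refine (h2.comp h1 (by simp; omega)).hom_eq ((represents_cast _ rfl
    (h4.of_eq (by rw [Nat.add_assoc]) rfl)).comp h3 (by simp; omega))
    (by simpa using h) (by simp; omega) fun t s ht hs _ => ?_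
  obtain ⟨A, B, C, rfl, hA, hB, hC⟩ := map_card_eq_triple hs
  obtain ⟨D, rfl, hD⟩ := map_card_eq_singleton ht
  refine sum_nested_eq hA hB hC (D := D) (fun P Q => ?_) fun P Q => ?_ <;>
    rw [mul_comm] <;>
    simp only [List.length_cons, List.length_nil, zero_add, Nat.reduceAdd, List.take_succ_cons,
      List.take_zero, List.drop_succ_cons, List.drop_zero, mergeMatrix_apply,
      indicator_mul_indicator, List.cons.injEq, and_true, eq_comm (a := P) (b := A),
      eq_comm (a := Q) (b := C)]

theorem eval_bigon (i j : WebLabel n) (h : i.1 + j.1 ≤ n) :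
    (comp (split (k := k) i j h) (merge i j h)).eval =
      (smul ((i.1 + j.1).choose i.1 : k) (id [i.add j h])).eval := by
  refine ((represents_split k i j h).comp (represents_merge k i j h) (by simp; omega)).hom_eq
    ((represents_id_label (i.add j h)).smul _) (by simpa using h) (by simpa using h)
    fun s t hs ht hw => ?_
  obtain ⟨A, rfl, hA⟩ := map_card_eq_singleton hs
  obtain ⟨A', rfl, hA'⟩ := map_card_eq_singleton ht
  obtain rfl := eq_of_subsetWeight_eq (hA.trans hA'.symm) (by simpa using hw)
  -- The intermediate pairs are a subset of `A` and its complement in `A`: the interval count with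
  -- lower end and intersection empty, upper end and union `A`.
  have hsum := sum_sum_interval k (a := i.1) (b := j.1) (Finset.Subset.refl ∅)
    (Finset.empty_subset A) (Finset.Subset.refl A) (by simp [hA])
  rw [Finset.card_empty, if_pos (Nat.zero_le _), Nat.sub_zero, Nat.sub_zero, hA] at hsum
  rw [sum_ofCards_pair, if_pos rfl, mul_one]
  refine Eq.trans ?_ (hsum.trans (Int.cast_natCast _))
  refine Finset.sum_congr rfl fun P _ => Finset.sum_congr rfl fun Q _ => ?_
  rw [mergeMatrix_apply, indicator_mul_indicator]
  refine if_congr ?_ rfl rfl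
  rw [and_self, Finset.disjoint_iff_inter_eq_empty]
  exact ⟨fun ⟨h1, h2⟩ => ⟨Finset.empty_subset _, h2 ▸ Finset.subset_union_left, h1, h2⟩,
    fun h => h.2.2⟩

/-- Only one subset has size `n`, so the matrices of the univalent vertices and of their composites
are one by one with entry `1`. -/
theorem eval_dot_codot (hn : 1 ≤ n) :
    (comp (dot (k := k) hn) (codot hn)).eval = (PreWeb.id (k := k) [WebLabel.top hn]).eval := by
  refine ((represents_dot k hn).comp (represents_codot k hn) (by simp)).hom_eq
    (represents_id_label (WebLabel.top hn)) (by simp) (by simp) fun s t hs ht _ => ?_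
  obtain ⟨A, rfl, hA⟩ := map_card_eq_singleton hs
  obtain ⟨B, rfl, hB⟩ := map_card_eq_singleton ht
  rw [sum_ofCards_nil, eq_of_card_eq_of_not (hA.trans hB.symm) (by omega), if_pos rfl, mul_one]

theorem eval_codot_dot (hn : 1 ≤ n) :
    (comp (codot (k := k) hn) (dot hn)).eval = (PreWeb.id (k := k) []).eval := by
  refine ((represents_codot k hn).comp (represents_dot k hn) (by simp)).hom_eq
    (Represents.id (c := []) rfl) (by simp) (by simp) fun s t hs ht _ => ?_
  obtain rfl := List.map_eq_nil_iff.1 hs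
  obtain rfl := List.map_eq_nil_iff.1 ht
  have := Finset.powersetCard_self (Finset.univ : Finset (Fin n))
  rw [Finset.card_univ, Fintype.card_fin] at this
  rw [sum_ofCards_cons, this, Finset.sum_singleton, sum_ofCards_nil, if_pos rfl, mul_one]

/-- The row of the matrix of a cap, and the column of the matrix of a cup. -/
def capMatrix (k : Type u) [Field k] (n : ℕ) : List (Finset (Fin n)) → k
  | [A, B] => if Disjoint A B then 1 else 0
  | _ => 0

theorem capMatrix_apply (A B : Finset (Fin n)) :
    capMatrix k n [A, B] = if Disjoint A B then 1 else 0 := rfl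

/-- Disjoint sets whose sizes add up to `n` cover everything, so disjointness is the only condition
left. -/
theorem sum_mergeMatrix_top {A B : Finset (Fin n)} (h : A.card + B.card = n) :
    ∑ v ∈ ofCards n [n], mergeMatrix k n [A, B] v = capMatrix k n [A, B] := by
  refine sum_eq_indicator [A ∪ B] _ (fun v hv => ?_) fun hK => ?_
  · obtain ⟨P, rfl, hP⟩ := map_card_eq_singleton (mem_ofCards.1 hv)
    refine if_congr ?_ rfl rfl
    simp only [List.cons.injEq, and_true, eq_comm (a := P)]
    exact and_comm
  · simp [mem_ofCards, Finset.card_union_of_disjoint hK, h]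

theorem represents_cap (i j : WebLabel n) (h : i.1 + j.1 = n) :
    Represents [i.1, j.1] [] (cap k i j h).eval fun s _ => capMatrix k n s := by
  refine (((represents_merge k i j h.le).of_eq rfl (by rw [h])).comp
    (represents_cast _ _ (represents_dot k (i.2.1.trans i.2.2))) (by simp)).congr
      fun s t hs _ => ?_
  obtain ⟨A, B, rfl, hA, hB⟩ := map_card_eq_pair hs
  simp only [mul_one]
  exact sum_mergeMatrix_top (by omega)

theorem represents_cup (i j : WebLabel n) (h : i.1 + j.1 = n) :
    Represents [] [i.1, j.1] (cup k i j h).eval fun _ t => capMatrix k n t := by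
  refine ((represents_codot k (i.2.1.trans i.2.2)).comp (represents_cast _ _
    ((represents_split k i j h.le).of_eq (by rw [h]) rfl)) (by simp)).congr
      fun s t _ ht => ?_
  obtain ⟨A, B, rfl, hA, hB⟩ := map_card_eq_pair ht
  simp only [one_mul]
  exact sum_mergeMatrix_top (by omega)

theorem eq_compl_of_disjoint {A B : Finset (Fin n)} (h : Disjoint A B) (hc : A.card + B.card = n) :
    B = Aᶜ := by
  refine Finset.eq_of_subset_of_card_le (Finset.subset_compl_iff_disjoint_left.2 h) ?_
  rw [Finset.card_compl, Fintype.card_fin]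
  omega

/-- The middle set is disjoint from `A` and has complementary size, hence is `Aᶜ`. Exactly one term
survives, and both snakes reduce to this sum. -/
theorem sum_snake {A : Finset (Fin n)} {i j : ℕ} (hA : A.card = i) (h : i + j = n)
    {f : List (Finset (Fin n)) → k}
    (hf : ∀ P Q R, f [P, Q, R] = if Disjoint P Q ∧ Disjoint Q R ∧ P = A ∧ R = A then 1 else 0) :
    ∑ v ∈ ofCards n [i, j, i], f v = 1 := by
  refine (sum_eq_indicator [A, Aᶜ, A] True (fun v hv => ?_) fun _ => ?_).trans (if_pos trivial)
  · obtain ⟨P, Q, R, rfl, hP, hQ, hR⟩ := map_card_eq_triple (mem_ofCards.1 hv)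
    rw [hf]
    simp only [List.cons.injEq, and_true]
    refine if_congr ⟨?_, ?_⟩ rfl rfl
    · rintro ⟨h1, -, rfl, rfl⟩
      exact ⟨rfl, eq_compl_of_disjoint h1 (by omega), rfl⟩
    · rintro ⟨rfl, rfl, rfl⟩
      exact ⟨disjoint_compl_right, disjoint_compl_left, rfl, rfl⟩
  · simp only [mem_ofCards, List.map_cons, List.map_nil, Finset.card_compl, Fintype.card_fin, hA,
      List.cons.injEq, and_true, true_and]
    omega

theorem eval_snake_left (i j : WebLabel n) (h : i.1 + j.1 = n) (h' : j.1 + i.1 = n) :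
    (id (k := k) [i]).eval =
      (comp (tensor (id [i]) (cup k j i h') : PreWeb k n [i] [i, j, i])
        (tensor (cap k i j h) (id [i]) : PreWeb k n [i, j, i] [i])).eval := by
  have h1 : Represents [i.1] [i.1, j.1, i.1] _ _ :=
    represents_tensor (represents_id_label i) (represents_cup (k := k) j i h')
  have h2 : Represents [i.1, j.1, i.1] [i.1] _ _ :=
    represents_tensor (represents_cap (k := k) i j h) (represents_id_label i)
  refine (represents_id_label i).hom_eq (h1.comp h2 (by simp; omega)) (by simp; omega)
    (by simp; omega) fun s t hs ht hw => ?_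
  obtain ⟨A, rfl, hA⟩ := map_card_eq_singleton hs
  obtain ⟨A', rfl, hA'⟩ := map_card_eq_singleton ht
  obtain rfl := eq_of_subsetWeight_eq (hA.trans hA'.symm) (by simpa using hw)
  rw [if_pos rfl]
  refine (sum_snake hA h fun P Q R => ?_).symm
  simp only [List.length_cons, List.length_nil, zero_add, Nat.reduceAdd, List.take_succ_cons,
    List.take_zero, List.drop_succ_cons, List.drop_zero, capMatrix_apply,
    indicator_mul_indicator, List.cons.injEq, and_true]
  refine if_congr ?_ rfl rfl
  rw [eq_comm (a := A)]
  tauto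

theorem eval_snake_right (i j : WebLabel n) (h : i.1 + j.1 = n) (h' : j.1 + i.1 = n) :
    (id (k := k) [i]).eval =
      (comp (tensor (cup k i j h) (id [i]) : PreWeb k n [i] [i, j, i])
        (tensor (id [i]) (cap k j i h') : PreWeb k n [i, j, i] [i])).eval := by
  have h1 : Represents [i.1] [i.1, j.1, i.1] _ _ :=
    represents_tensor (represents_cup (k := k) i j h) (represents_id_label i)
  have h2 : Represents [i.1, j.1, i.1] [i.1] _ _ :=
    represents_tensor (represents_id_label i) (represents_cap (k := k) j i h')
  refine (represents_id_label i).hom_eq (h1.comp h2 (by simp; omega)) (by simp; omega)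
    (by simp; omega) fun s t hs ht hw => ?_
  obtain ⟨A, rfl, hA⟩ := map_card_eq_singleton hs
  obtain ⟨A', rfl, hA'⟩ := map_card_eq_singleton ht
  obtain rfl := eq_of_subsetWeight_eq (hA.trans hA'.symm) (by simpa using hw)
  rw [if_pos rfl]
  refine (sum_snake hA h fun P Q R => ?_).symm
  simp only [List.length_cons, List.length_nil, zero_add, Nat.reduceAdd, List.take_succ_cons,
    List.take_zero, List.drop_succ_cons, List.drop_zero, capMatrix_apply,
    indicator_mul_indicator, List.cons.injEq, and_true]
  refine if_congr ?_ rfl rfl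
  rw [eq_comm (a := A)]
  tauto

theorem eval_eq_of_webRel {a b : List (WebLabel n)} {f g : PreWeb k n a b} (h : WebRel k n f g) :
    f.eval = g.eval := by
  cases h with
  | merge_assoc i j l h => exact eval_merge_assoc i j l h
  | split_assoc i j l h => exact eval_split_assoc i j l h
  | bigon i j h => exact eval_bigon i j h
  | square_switch_right m l m' l' i j hm hl hm' hl' h₁ h₂ =>
    exact eval_square_switch_right hm hl hm' hl' h₁ h₂
  | square_switch_left m l m' l' i j hm hl hm' hl' h₁ h₂ =>
    exact eval_square_switch_left hm hl hm' hl' h₁ h₂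
  | dot_codot hn => exact eval_dot_codot hn
  | codot_dot hn => exact eval_codot_dot hn
  | snake_left i j h h' => exact eval_snake_left i j h h'
  | snake_right i j h h' => exact eval_snake_right i j h h'

end Soundness

/-! ## The functor -/

namespace GPA

variable {k : Type u} [Field k] {V : Type v} {L : Type w} {Γ : LabeledGraph V L}

theorem add_tensorHom {X Y X' Y' : GPA k Γ} (f f' : X ⟶ Y) (g : X' ⟶ Y') :
    tensorHom (f + f') g = tensorHom f g + tensorHom f' g :=
  hom_ext fun _ _ => add_mul _ _ _

theorem tensorHom_add {X Y X' Y' : GPA k Γ} (f : X ⟶ Y) (g g' : X' ⟶ Y') :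
    tensorHom f (g + g') = tensorHom f g + tensorHom f g' :=
  hom_ext fun _ _ => mul_add _ _ _

theorem smul_tensorHom {X Y X' Y' : GPA k Γ} (r : k) (f : X ⟶ Y) (g : X' ⟶ Y') :
    tensorHom (r • f) g = r • tensorHom f g :=
  hom_ext fun _ _ => mul_assoc _ _ _

theorem tensorHom_smul {X Y X' Y' : GPA k Γ} (r : k) (f : X ⟶ Y) (g : X' ⟶ Y') :
    tensorHom f (r • g) = r • tensorHom f g :=
  hom_ext fun _ _ => mul_left_comm _ _ _

/-- The tensor product of two morphisms, regarded as a morphism between objects that are equal to the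
tensor products of the sources and of the targets. -/
noncomputable def tensorHomOf {W Z X Y X' Y' : GPA k Γ} (h : W = tensorObj X X')
    (h' : Z = tensorObj Y Y') (f : X ⟶ Y) (g : X' ⟶ Y') : W ⟶ Z :=
  eqToHom h ≫ tensorHom f g ≫ eqToHom h'.symm

theorem tensorHomOf_comp {W W' W'' X Y Z X' Y' Z' : GPA k Γ} (h : W = tensorObj X X')
    (h' : W' = tensorObj Y Y') (h'' : W'' = tensorObj Z Z') (f : X ⟶ Y) (g : Y ⟶ Z) (f' : X' ⟶ Y')
    (g' : Y' ⟶ Z') :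
    tensorHomOf h h'' (f ≫ g) (f' ≫ g') = tensorHomOf h h' f f' ≫ tensorHomOf h' h'' g g' := by
  subst h h' h''
  simp [tensorHomOf, tensorHom_comp]

theorem tensorHomOf_id {W X Y : GPA k Γ} (h : W = tensorObj X Y) :
    tensorHomOf h h (𝟙 X) (𝟙 Y) = 𝟙 W := by
  subst h
  simp [tensorHomOf, tensorHom_id]

/-- The composite objects are variables tied down by equations, so that the equations can be
substituted away. For the concrete objects `reduceSeq (a ++ b)` this would be impossible. -/
theorem tensorHomOf_assoc {X Y Z X' Y' Z' XY YZ XY' YZ' W₁ W₂ W₁' W₂' : GPA k Γ}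
    (hXY : XY = tensorObj X Y) (hYZ : YZ = tensorObj Y Z) (hXY' : XY' = tensorObj X' Y')
    (hYZ' : YZ' = tensorObj Y' Z') (h₁ : W₁ = tensorObj XY Z) (h₁' : W₁' = tensorObj XY' Z')
    (h₂ : W₂ = tensorObj X YZ) (h₂' : W₂' = tensorObj X' YZ') (e : W₂ = W₁) (e' : W₁' = W₂')
    (f : X ⟶ X') (g : Y ⟶ Y') (h : Z ⟶ Z') :
    eqToHom e ≫ tensorHomOf h₁ h₁' (tensorHomOf hXY hXY' f g) h ≫ eqToHom e' =
      tensorHomOf h₂ h₂' f (tensorHomOf hYZ hYZ' g h) := by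
  subst hXY hYZ hXY' hYZ' h₁ h₁' h₂ h₂'
  simp only [tensorHomOf, eqToHom_refl, Category.id_comp, Category.comp_id]
  rw [tensorHom_assoc, eqToHom_trans_assoc, eqToHom_refl, Category.id_comp]

theorem tensorHomOf_id_nil {X Y W Z : GPA k Γ} (h : W = tensorObj X ⟨[]⟩)
    (h' : Z = tensorObj Y ⟨[]⟩) (e : X = W) (e' : Z = Y) (f : X ⟶ Y) :
    eqToHom e ≫ tensorHomOf h h' f (𝟙 (⟨[]⟩ : GPA k Γ)) ≫ eqToHom e' = f := by
  subst h h'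
  simp only [tensorHomOf, eqToHom_refl, Category.id_comp, Category.comp_id]
  rw [tensorHom_unit_right, eqToHom_trans_assoc, eqToHom_refl, Category.id_comp]

theorem id_nil_tensorHomOf {X Y W Z : GPA k Γ} (h : W = tensorObj ⟨[]⟩ X)
    (h' : Z = tensorObj ⟨[]⟩ Y) (e : X = W) (e' : Z = Y) (f : X ⟶ Y) :
    eqToHom e ≫ tensorHomOf h h' (𝟙 (⟨[]⟩ : GPA k Γ)) f ≫ eqToHom e' = f := by
  subst h h'
  simp only [tensorHomOf, eqToHom_refl, Category.id_comp, Category.comp_id]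
  rw [tensorHom_unit_left, eqToHom_trans_assoc, eqToHom_refl, Category.id_comp]

end GPA

theorem mk_reduceSeq_append {k : Type u} {n : ℕ} (a b : List (WebLabel n)) :
    (⟨reduceSeq (a ++ b)⟩ : GPA k (weightGraph n)) =
      GPA.tensorObj ⟨reduceSeq a⟩ ⟨reduceSeq b⟩ := congrArg GPA.mk (reduceSeq_append a b)

/-! ### Evaluation on the quotient and strict monoidality -/

section

variable {k : Type u} [Field k] {n : ℕ}

theorem PreWeb.eval_tensor_add {a b c d : List (WebLabel n)} (f : PreWeb k n a b)
    (g g' : PreWeb k n c d) : (PreWeb.tensor f (.add g g')).eval =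
      (PreWeb.tensor f g).eval + (PreWeb.tensor f g').eval := by
  refine (congrArg (fun φ => eqToHom _ ≫ φ ≫ eqToHom _) (GPA.tensorHom_add _ _ _)).trans ?_
  refine (congrArg _ (Preadditive.add_comp _ _ _ _ _ _)).trans (Preadditive.comp_add _ _ _ _ _ _)

theorem PreWeb.eval_add_tensor {a b c d : List (WebLabel n)} (f f' : PreWeb k n a b)
    (g : PreWeb k n c d) : (PreWeb.tensor (.add f f') g).eval =
      (PreWeb.tensor f g).eval + (PreWeb.tensor f' g).eval := by
  refine (congrArg (fun φ => eqToHom _ ≫ φ ≫ eqToHom _) (GPA.add_tensorHom _ _ _)).trans ?_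
  refine (congrArg _ (Preadditive.add_comp _ _ _ _ _ _)).trans (Preadditive.comp_add _ _ _ _ _ _)

theorem PreWeb.eval_tensor_smul {a b c d : List (WebLabel n)} (r : k) (f : PreWeb k n a b)
    (g : PreWeb k n c d) : (PreWeb.tensor f (.smul r g)).eval = r • (PreWeb.tensor f g).eval := by
  refine (congrArg (fun φ => eqToHom _ ≫ φ ≫ eqToHom _) (GPA.tensorHom_smul _ _ _)).trans ?_
  exact (congrArg _ (Linear.smul_comp _ _ _ _ _ _)).trans (Linear.comp_smul _ _ _ _ _ _)

theorem PreWeb.eval_smul_tensor {a b c d : List (WebLabel n)} (r : k) (f : PreWeb k n a b)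
    (g : PreWeb k n c d) : (PreWeb.tensor (.smul r f) g).eval = r • (PreWeb.tensor f g).eval := by
  refine (congrArg (fun φ => eqToHom _ ≫ φ ≫ eqToHom _) (GPA.smul_tensorHom _ _ _)).trans ?_
  exact (congrArg _ (Linear.smul_comp _ _ _ _ _ _)).trans (Linear.comp_smul _ _ _ _ _ _)

/-- Apart from the defining relations, every case is an axiom of a linear monoidal category in the
target. Only the tensor cases involve transport, and there the evaluation is a `GPA.tensorHomOf` by
definition. -/
theorem eval_eq_of_webCong {a b : List (WebLabel n)} {f g : PreWeb k n a b}
    (h : WebCong k n f g) : f.eval = g.eval := by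
  induction h with
  | rel h => exact eval_eq_of_webRel h
  | refl f => rfl
  | symm _ ih => exact ih.symm
  | trans _ _ ih ih' => exact ih.trans ih'
  | comp_congr _ _ ih ih' => exact congrArg₂ (· ≫ ·) ih ih'
  | tensor_congr _ _ ih ih' =>
      exact congrArg₂ (GPA.tensorHomOf (mk_reduceSeq_append _ _) (mk_reduceSeq_append _ _)) ih ih'
  | add_congr _ _ ih ih' => exact congrArg₂ (· + ·) ih ih'
  | smul_congr r _ ih => exact congrArg (r • ·) ih
  | id_comp f => exact Category.id_comp f.eval
  | comp_id f => exact Category.comp_id f.eval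
  | comp_assoc f g h => exact Category.assoc f.eval g.eval h.eval
  | add_assoc f g h => exact add_assoc f.eval g.eval h.eval
  | add_comm f g => exact add_comm f.eval g.eval
  | zero_add f => exact zero_add f.eval
  | zero_smul f => exact zero_smul k f.eval
  | one_smul f => exact one_smul k f.eval
  | mul_smul r s f => exact mul_smul r s f.eval
  | add_smul r s f => exact add_smul r s f.eval
  | smul_add r f g => exact smul_add r f.eval g.eval
  | add_comp f f' g => exact Preadditive.add_comp _ _ _ f.eval f'.eval g.eval
  | comp_add f g g' => exact Preadditive.comp_add _ _ _ f.eval g.eval g'.eval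
  | smul_comp r f g => exact Linear.smul_comp _ _ _ r f.eval g.eval
  | comp_smul r f g => exact Linear.comp_smul _ _ _ f.eval r g.eval
  | add_tensor f f' g => exact PreWeb.eval_add_tensor f f' g
  | tensor_add f g g' => exact PreWeb.eval_tensor_add f g g'
  | smul_tensor r f g => exact PreWeb.eval_smul_tensor r f g
  | tensor_smul r f g => exact PreWeb.eval_tensor_smul r f g
  | tensor_id a b => exact GPA.tensorHomOf_id _
  | interchange f g f' g' => 
    exact GPA.tensorHomOf_comp (mk_reduceSeq_append _ _) (mk_reduceSeq_append _ _)
      (mk_reduceSeq_append _ _) _ _ _ _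
  | tensor_assoc f g h =>
    rw [PreWeb.eval_cast]
    exact GPA.tensorHomOf_assoc (mk_reduceSeq_append _ _) (mk_reduceSeq_append _ _)
      (mk_reduceSeq_append _ _) (mk_reduceSeq_append _ _) (mk_reduceSeq_append _ _)
      (mk_reduceSeq_append _ _) (mk_reduceSeq_append _ _) (mk_reduceSeq_append _ _) _ _ f.eval g.eval h.eval
  | id_nil_tensor f =>
    refine Eq.trans ?_ (GPA.id_nil_tensorHomOf (mk_reduceSeq_append [] _)
      (mk_reduceSeq_append [] _) rfl rfl f.eval)
    exact ((Category.id_comp _).trans (Category.comp_id _)).symm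
  | tensor_id_nil f =>
    rw [PreWeb.eval_cast]
    exact GPA.tensorHomOf_id_nil (mk_reduceSeq_append _ []) (mk_reduceSeq_append _ []) _ _ f.eval

/-- The morphism of the graph planar algebra assigned to a web. -/
noncomputable def Web.eval {X Y : Web k n} (f : X ⟶ Y) : X.reduce ⟶ Y.reduce :=
  Quotient.lift (fun g : PreWeb k n X.seq Y.seq => g.eval) (fun _ _ h => eval_eq_of_webCong h) f

theorem Web.eval_comp {X Y Z : Web k n} (f : X ⟶ Y) (g : Y ⟶ Z) :
    Web.eval (f ≫ g) = Web.eval f ≫ Web.eval g := by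
  obtain ⟨f, rfl⟩ := Quotient.exists_rep f
  obtain ⟨g, rfl⟩ := Quotient.exists_rep g
  rfl

theorem Web.eval_tensorHom {X Y X' Y' : Web k n} (f : X ⟶ Y) (g : X' ⟶ Y') :
    Web.eval (Web.tensorHom f g) =
      GPA.tensorHomOf (Web.reduce_tensor X X') (Web.reduce_tensor Y Y') (Web.eval f)
        (Web.eval g) := by
  obtain ⟨f, rfl⟩ := Quotient.exists_rep f
  obtain ⟨g, rfl⟩ := Quotient.exists_rep g
  rfl

/-- The functor from webs to the graph planar algebra of the weight lattice. -/
noncomputable def webFunctor (k : Type u) [Field k] (n : ℕ) : Web k n ⥤ GPA k (weightGraph n) where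
  obj X := X.reduce
  map f := Web.eval f
  map_id _ := rfl
  map_comp := Web.eval_comp

instance : (webFunctor k n).Additive where
  map_add {_ _ f g} := by
    obtain ⟨f, rfl⟩ := Quotient.exists_rep f
    obtain ⟨g, rfl⟩ := Quotient.exists_rep g
    rfl

instance : (webFunctor k n).Linear k where
  map_smul f r := by
    obtain ⟨f, rfl⟩ := Quotient.exists_rep f
    rfl

theorem GPA.eqToHom_tensorHom_id {X Y : GPA k (weightGraph n)} (h : X = Y)
    (Z : GPA k (weightGraph n)) :
    GPA.tensorHom (eqToHom h) (𝟙 Z) = eqToHom (congrArg (GPA.tensorObj · Z) h) :=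
  GPA.tensorHom_eqToHom h rfl

theorem GPA.id_tensorHom_eqToHom {X Y : GPA k (weightGraph n)} (h : X = Y)
    (Z : GPA k (weightGraph n)) :
    GPA.tensorHom (𝟙 Z) (eqToHom h) = eqToHom (congrArg (GPA.tensorObj Z ·) h) :=
  GPA.tensorHom_eqToHom rfl h

theorem eqToHom_eq_comp_comp {C : Type*} [Category C] {W X Y Z : C} (h : W = Z) (h₁ : W = X)
    (h₂ : X = Y) (h₃ : Y = Z) : eqToHom h = eqToHom h₁ ≫ eqToHom h₂ ≫ eqToHom h₃ := by
  rw [eqToHom_trans, eqToHom_trans]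

theorem eqToHom_comp_comp_eq {C : Type*} [Category C] {W X X' Y Y' Z : C} (h₁ : W = X)
    (h₂ : X = Y) (h₃ : Y = Z) (h₁' : W = X') (h₂' : X' = Y') (h₃' : Y' = Z) :
    eqToHom h₁ ≫ eqToHom h₂ ≫ eqToHom h₃ = eqToHom h₁' ≫ eqToHom h₂' ≫ eqToHom h₃' := by
  simp only [eqToHom_trans]

theorem GPA.tensorHom_comp_eqToHom {X Y X' Y' W Z : GPA k (weightGraph n)}
    (h : W = GPA.tensorObj X X') (h' : Z = GPA.tensorObj Y Y') (f : X ⟶ Y) (g : X' ⟶ Y') :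
    GPA.tensorHom f g ≫ eqToHom h'.symm = eqToHom h.symm ≫ GPA.tensorHomOf h h' f g := by
  rw [GPA.tensorHomOf, eqToHom_trans_assoc, eqToHom_refl, Category.id_comp]

/-- The strict monoidal structure of the functor. -/
noncomputable def webFunctorCoreMonoidal (k : Type u) [Field k] (n : ℕ) :
    (webFunctor k n).CoreMonoidal where
  εIso := eqToIso Web.reduce_unit.symm
  μIso X Y := eqToIso (Web.reduce_tensor X Y).symm
  μIso_hom_natural_left {X Y} f X' := by
    refine (GPA.tensorHom_comp_eqToHom (Web.reduce_tensor X X') (Web.reduce_tensor Y X') _ _).trans ?_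
    exact congrArg _ (Web.eval_tensorHom f (𝟙 X')).symm
  μIso_hom_natural_right {X Y} X' f := by
    refine (GPA.tensorHom_comp_eqToHom (Web.reduce_tensor X' X) (Web.reduce_tensor X' Y) _ _).trans ?_
    exact congrArg _ (Web.eval_tensorHom (𝟙 X') f).symm
  associativity X Y Z := by
    -- All structure morphisms are of the form `eqToHom`, so the coherence condition compares two
    -- composites of such morphisms with the same ends.
    refine (congrArg₂ (· ≫ ·) (GPA.eqToHom_tensorHom_id (Web.reduce_tensor X Y).symm _)
      (congrArg₂ (· ≫ ·) rfl
      (eqToHom_map (webFunctor k n) (Web.tensorObj_assoc X Y Z)))).trans ?_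
    refine Eq.trans ?_ (congrArg₂ (· ≫ ·) rfl (congrArg₂ (· ≫ ·)
      (GPA.id_tensorHom_eqToHom (Web.reduce_tensor Y Z).symm _) rfl)).symm
    exact eqToHom_comp_comp_eq (congrArg (GPA.tensorObj · Z.reduce) (Web.reduce_tensor X Y).symm)
      (Web.reduce_tensor (Web.tensorObj X Y) Z).symm
      (congrArg Web.reduce (Web.tensorObj_assoc X Y Z))
      (GPA.tensorObj_assoc X.reduce Y.reduce Z.reduce)
      (congrArg (GPA.tensorObj X.reduce ·) (Web.reduce_tensor Y Z).symm)
      (Web.reduce_tensor X (Web.tensorObj Y Z)).symm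
  left_unitality X := by
    refine Eq.trans ?_ (congrArg₂ (· ≫ ·) (GPA.eqToHom_tensorHom_id Web.reduce_unit.symm _)
      (congrArg₂ (· ≫ ·) rfl
      (eqToHom_map (webFunctor k n) (Web.nil_tensorObj X)))).symm
    exact eqToHom_eq_comp_comp (GPA.nil_tensorObj X.reduce)
      (congrArg (GPA.tensorObj · X.reduce) Web.reduce_unit.symm)
      (Web.reduce_tensor ⟨[]⟩ X).symm (congrArg Web.reduce (Web.nil_tensorObj X))
  right_unitality X := by
    refine Eq.trans ?_ (congrArg₂ (· ≫ ·) (GPA.id_tensorHom_eqToHom Web.reduce_unit.symm _)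
      (congrArg₂ (· ≫ ·) rfl
      (eqToHom_map (webFunctor k n) (Web.tensorObj_nil X)))).symm
    exact eqToHom_eq_comp_comp (GPA.tensorObj_nil X.reduce)
      (congrArg (GPA.tensorObj X.reduce ·) Web.reduce_unit.symm)
      (Web.reduce_tensor X ⟨[]⟩).symm (congrArg Web.reduce (Web.tensorObj_nil X))

end

/-- For the `sl_n` weight lattice `Γ` and an arbitrary field `k`, sending the entries equal to `n` to
the empty sequence, the trivalent vertices to the triangle indicators, and the univalent vertices to
the indicators of the empty paths defines a `k`-linear strict monoidal functor
`Web(SL_n^-) ⥤ G(Γ)`. -/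
theorem mainTheorem6 (k : Type u) [Field k] (n : ℕ) (hn : 1 ≤ n) :
    ∃ (F : Web k n ⥤ GPA k (weightGraph n)) (hobj : ∀ X : Web k n, F.obj X = X.reduce)
      (_ : F.Additive) (_ : F.Linear k) (_ : F.Monoidal),
      Functor.LaxMonoidal.ε F = eqToHom (Web.reduce_unit.symm.trans (hobj _).symm) ∧
      (∀ X Y : Web k n, Functor.LaxMonoidal.μ F X Y =
        eqToHom (by rw [hobj, hobj, hobj, Web.reduce_tensor])) ∧
      (∀ (i j : WebLabel n) (h : i.1 + j.1 ≤ n),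
        F.map (Web.ofPreWeb (.merge i j h)) =
          eqToHom (hobj _) ≫ GPA.triangle (Web.reduce ⟨[i, j]⟩) (Web.reduce ⟨[i.add j h]⟩) ≫
            eqToHom (hobj _).symm) ∧
      (∀ (i j : WebLabel n) (h : i.1 + j.1 ≤ n),
        F.map (Web.ofPreWeb (.split i j h)) =
          eqToHom (hobj _) ≫ GPA.triangle (Web.reduce ⟨[i.add j h]⟩) (Web.reduce ⟨[i, j]⟩) ≫
            eqToHom (hobj _).symm) ∧
      F.map (Web.ofPreWeb (.dot hn)) =
        eqToHom (hobj _) ≫ GPA.triangle (Web.reduce ⟨[WebLabel.top hn]⟩) (Web.reduce ⟨[]⟩) ≫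
          eqToHom (hobj _).symm ∧
      F.map (Web.ofPreWeb (.codot hn)) =
        eqToHom (hobj _) ≫ GPA.triangle (Web.reduce ⟨[]⟩) (Web.reduce ⟨[WebLabel.top hn]⟩) ≫
          eqToHom (hobj _).symm := by
  let hF : (webFunctor k n).Monoidal := (webFunctorCoreMonoidal k n).toMonoidal
  refine ⟨webFunctor k n, fun _ => rfl, inferInstance, inferInstance, hF, rfl,
    fun _ _ => rfl, fun i j h => ?_, fun i j h => ?_, ?_, ?_⟩ <;>
  -- The equality on objects is `rfl`, so both `eqToHom` factors are identities, and a generator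
  -- evaluates to its triangle map by definition.
  exact ((Category.id_comp _).trans (Category.comp_id _)).symm
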